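/- Let $I_1,I_3,M_1,M_3,m,g,l\in\mathbb R$ with $I_1,I_3,M_1,M_3>0$ and $I_1M_1-m^2l^2>0$, put $I=\mathrm{diag}(I_1,I_1,I_3)$, $M=\mathrm{diag}(M_1,M_1,M_3)$, and let $e_1,e_2,e_3$ be the standard basis of $\mathbb R^3$. The Kirchhoff model of a neutrally buoyant axisymmetric underwater vehicle has phase space $T^*SE(3)\cong SE(3)\times\mathbb R^3\times\mathbb R^3\ni(A,b,\Pi,P)$, where $\Pi=I\Omega+ml\,e_3\times v$ and $P=Mv-ml\,e_3\times\Omega$; its Hamiltonian is $H=\frac12\Omega\cdot\Pi+\frac12 v\cdot P-mgl\,(e_3\cdot Ae_3)$ and its equations of motion are $$A'=A\widehat\Omega,\quad b'=Av,\quad \Pi'=\Pi\times\Omega+P\times v-mgl\,\Gamma\times e_3,\quad P'=P\times\Omega,\qquad \Gamma=A^Te_3 .$$ The group $\mathcal G=SO(2)\ltimes\mathbb R^3\times SO(2)$ acts by symmetries, $(\phi,a,\theta)\cdot(A,b,\Pi,P)=(R_\phi AR_\theta^{-1},\,R_\phi b+a,\,R_\theta\Pi,\,R_\theta P)$, where $R_\phi$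 is the rotation by $\phi$ about $e_3$. The momentum map of the subgroup $\mathcal K=\mathbb R^3\times SO(2)$ of the elements $(0,a,\theta)$ is $J^{\mathcal K}=(AP,\,-\Pi\cdot e_3)$. For $P_e,S_e\in\mathbb R$ let $x_e=(\mathrm{id},0,S_ee_3,P_ee_3)$, the axisymmetric relative equilibrium with linear momentum $P_e$ and spin momentum $S_e$. Near $x_e$ the symplectic reduced space of $\mathcal K$ at the momentum $\nu=(\nu^a,\nu^\theta)$ has canonical coordinates $w=(q_1,q_2,p_1,p_2)$: the point $w$ is represented by the $(A,b,\Pi,P)$ with $J^{\mathcal K}=\nu$ and, writing $q=q_1e_1+q_2e_2$ and $x=-e_3\times q$, with $A=\mathrm{id}+\widehat x+\widehat x^{\,2}/(1+\sqrt{1-\|q\|^2})$ and $b=ml\,M^{-1}q$, for which $p_1,p_2$ are the momenta conjugate to $q_1,q_2$. Let $H(\nu,w)$ be the value of the Hamiltonian at that point and $\nu_e=J^{\mathcal K}(x_e)$; then $x_e$ is the point $w=0$ at $\nu=\nu_e$. Let $\mathbb J$ be the standard $4\times4$ symplectic matrix, so that the reduced system is $\dot w=\mathbb J\,D_wH(\nu,w)$.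 1. If $mgl>\left(\frac1{M_3}-\frac1{M_1}\right)P_e^2$, then $x_e$ is $\mathcal G$-stable by energy-momentum confinement. That is, $w=0$ is an equilibrium of the reduced system at $\nu_e$ at which the Hessian $D_w^2H(\nu_e,0)$ is definite; and for every $\mathcal G$-invariant open set $U\ni x_e$ there is a neighbourhood $N$ of $x_e$ such that, through every point of $N$ at time $0$, a motion exists for all times, and every such motion stays in $U$ for all times. 2. If $mgl>\left(\frac1{M_3}-\frac1{M_1}\right)P_e^2-\frac{M_1}{4(I_1M_1-m^2l^2)}S_e^2$, then $x_e$ is spectrally stable. That is, $w=0$ is an equilibrium of the reduced system at $\nu_e$ and all eigenvalues of its linearization $\mathbb J D_w^2H(\nu_e,0)$ are purely imaginary (possibly zero). -/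

import Mathlib

open scoped Matrix Topology

noncomputable section

namespace Kirchhoff

/-- Vectors of `ℝ³` (only their topology and linear structure are used). -/
abbrev Vec : Type := Fin 3 → ℝ

/-- The unit vector along the vertical axis. -/
def e₃ : Vec := ![0, 0, 1]

/-- The antisymmetric matrix with `hat v *ᵥ w = v × w`. -/
def hat (v : Vec) : Matrix (Fin 3) (Fin 3) ℝ :=
  !![0, -v 2, v 1; v 2, 0, -v 0; -v 1, v 0, 0]

/-- Rotation by the angle `φ` about the vertical axis, i.e. `exp (φ • hat e₃)`. -/
def rotMat (φ : Real.Angle) : Matrix (Fin 3) (Fin 3) ℝ :=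
  !![φ.cos, -φ.sin, 0; φ.sin, φ.cos, 0; 0, 0, 1]

theorem rotMat_zero : rotMat 0 = 1 := by
  ext i j; fin_cases i <;> fin_cases j <;> simp [rotMat]

theorem rotMat_add (φ ψ : Real.Angle) : rotMat (φ + ψ) = rotMat φ * rotMat ψ := by
  ext i j
  fin_cases i <;> fin_cases j <;>
    simp [rotMat, Matrix.mul_apply, Fin.sum_univ_three, Real.Angle.cos_add, Real.Angle.sin_add] <;>
    ring

theorem rotMat_mem (φ : Real.Angle) : rotMat φ ∈ Matrix.specialOrthogonalGroup (Fin 3) ℝ := by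
  have h := Real.Angle.cos_sq_add_sin_sq φ
  rw [Matrix.mem_specialOrthogonalGroup_iff, Matrix.mem_orthogonalGroup_iff]
  constructor
  · ext i j
    fin_cases i <;> fin_cases j <;>
      simp [rotMat, Matrix.mul_apply, Fin.sum_univ_three] <;>
      linarith
  · simp [rotMat, Matrix.det_fin_three]
    linear_combination h

/-- `rotMat` as an element of `SO(3)`. -/
def rot (φ : Real.Angle) : Matrix.specialOrthogonalGroup (Fin 3) ℝ := ⟨rotMat φ, rotMat_mem φ⟩

theorem rot_zero : rot 0 = 1 := Subtype.ext rotMat_zero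

theorem rot_add (φ ψ : Real.Angle) : rot (φ + ψ) = rot φ * rot ψ := Subtype.ext (rotMat_add φ ψ)

/-! ### The symmetry group -/

/-- The group `SO(2) ⋉ ℝ³ × SO(2)`: a rotation `φ` of space about the vertical axis, a
translation `a` of space, and a rotation `θ` of the body about its symmetry axis. -/
@[ext] structure Sym : Type where
  φ : Real.Angle
  a : Vec
  θ : Real.Angle

namespace Sym

instance : One Sym := ⟨⟨0, 0, 0⟩⟩
instance : Mul Sym := ⟨fun g h => ⟨g.φ + h.φ, g.a + rotMat g.φ *ᵥ h.a, g.θ + h.θ⟩⟩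
instance : Inv Sym := ⟨fun g => ⟨-g.φ, -(rotMat (-g.φ) *ᵥ g.a), -g.θ⟩⟩

@[simp] theorem one_φ : (1 : Sym).φ = 0 := rfl
@[simp] theorem one_a : (1 : Sym).a = 0 := rfl
@[simp] theorem one_θ : (1 : Sym).θ = 0 := rfl
@[simp] theorem mul_φ (g h : Sym) : (g * h).φ = g.φ + h.φ := rfl
@[simp] theorem mul_a (g h : Sym) : (g * h).a = g.a + rotMat g.φ *ᵥ h.a := rfl
@[simp] theorem mul_θ (g h : Sym) : (g * h).θ = g.θ + h.θ := rfl
@[simp] theorem inv_φ (g : Sym) : (g⁻¹).φ = -g.φ := rfl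
@[simp] theorem inv_a (g : Sym) : (g⁻¹).a = -(rotMat (-g.φ) *ᵥ g.a) := rfl
@[simp] theorem inv_θ (g : Sym) : (g⁻¹).θ = -g.θ := rfl

instance : Group Sym := Group.ofLeftAxioms
  (fun g h k => by
    ext1
    · simp [add_assoc]
    · simp [rotMat_add, Matrix.mulVec_add, Matrix.mulVec_mulVec, add_assoc]
    · simp [add_assoc])
  (fun g => by ext1 <;> simp [rotMat_zero])
  (fun g => by ext1 <;> simp)

end Sym

/-! ### The phase space and the motions -/

/-- The phase space `T*SE(3)` in body coordinates: attitude `A`, position `b`, and the body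
angular and linear momenta `Π`, `P`. -/
@[ext] structure Phase : Type where
  A : Matrix.specialOrthogonalGroup (Fin 3) ℝ
  b : Vec
  ang : Vec
  lin : Vec

instance : TopologicalSpace Phase :=
  TopologicalSpace.induced (fun x => (x.A, x.b, x.ang, x.lin)) inferInstance

/-- Space is rotated and translated on the left; the body is rotated by multiplication of
`(A, b)` by the inverse of the rotation on the right, which rotates the body momenta. -/
instance : MulAction Sym Phase where
  smul g x := ⟨rot g.φ * x.A * rot (-g.θ), rotMat g.φ *ᵥ x.b + g.a,
    rotMat g.θ *ᵥ x.ang, rotMat g.θ *ᵥ x.lin⟩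
  one_smul x := by
    change Phase.mk _ _ _ _ = x
    ext1 <;> simp [rot_zero, rotMat_zero]
  mul_smul g h x := by
    change Phase.mk _ _ _ _ = Phase.mk _ _ _ _
    ext1
    · change _ = rot g.φ * (rot h.φ * x.A * rot (-h.θ)) * rot (-g.θ)
      simp [neg_add_rev, rot_add, mul_assoc]
    · change _ = rotMat g.φ *ᵥ (rotMat h.φ *ᵥ x.b + h.a) + g.a
      simp [rotMat_add, Matrix.mulVec_add, Matrix.mulVec_mulVec]
      abel
    · change _ = rotMat g.θ *ᵥ (rotMat h.θ *ᵥ x.ang)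
      simp [rotMat_add, Matrix.mulVec_mulVec]
    · change _ = rotMat g.θ *ᵥ (rotMat h.θ *ᵥ x.lin)
      simp [rotMat_add, Matrix.mulVec_mulVec]

/-- The constants of the vehicle: added inertia `diag (I₁, I₁, I₃)`, added mass
`diag (M₁, M₁, M₃)`, mass `m`, gravity `g`, and distance `l` of the center of mass below the
center of buoyancy. -/
structure Vehicle : Type where
  I₁ : ℝ
  I₃ : ℝ
  M₁ : ℝ
  M₃ : ℝ
  m : ℝ
  g : ℝ
  l : ℝ

namespace Vehicle

variable (V : Vehicle)

/-- The constant `I₁ M₁ - m² l²`. -/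
def Δ : ℝ := V.I₁ * V.M₁ - V.m ^ 2 * V.l ^ 2

/-- The body angular velocity `Ω` as a function of the momenta. -/
def angVel (Pa Pl : Vec) : Vec :=
  ![(V.M₁ * Pa 0 + V.m * V.l * Pl 1) / V.Δ, (V.M₁ * Pa 1 - V.m * V.l * Pl 0) / V.Δ, Pa 2 / V.I₃]

/-- The body translational velocity `v` as a function of the momenta. -/
def vel (Pa Pl : Vec) : Vec :=
  ![(V.I₁ * Pl 0 - V.m * V.l * Pa 1) / V.Δ, (V.I₁ * Pl 1 + V.m * V.l * Pa 0) / V.Δ, Pl 2 / V.M₃]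

/-- The formulas for `Ω` and `v` invert the Legendre transformation
`Π = IΩ + ml e₃ × v`, `P = Mv - ml e₃ × Ω`. -/
theorem legendre (h₃ : V.I₃ ≠ 0) (hM : V.M₃ ≠ 0) (hΔ : V.Δ ≠ 0) (Pa Pl : Vec) :
    Matrix.diagonal ![V.I₁, V.I₁, V.I₃] *ᵥ V.angVel Pa Pl
        + (V.m * V.l) • (e₃ ⨯₃ V.vel Pa Pl) = Pa ∧
      Matrix.diagonal ![V.M₁, V.M₁, V.M₃] *ᵥ V.vel Pa Pl
        - (V.m * V.l) • (e₃ ⨯₃ V.angVel Pa Pl) = Pl := by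
  have hd : V.Δ = V.I₁ * V.M₁ - V.m ^ 2 * V.l ^ 2 := rfl
  constructor <;> ext i <;> fin_cases i <;>
    simp [e₃, angVel, vel, Matrix.mulVec_diagonal, cross_apply] <;> field_simp <;>
    rw [hd] <;> ring

/-- The Hamiltonian `½ Ω·Π + ½ v·P - mgl e₃·A e₃`. -/
def energy (A : Matrix (Fin 3) (Fin 3) ℝ) (Pa Pl : Vec) : ℝ :=
  1 / 2 * (V.angVel Pa Pl ⬝ᵥ Pa) + 1 / 2 * (V.vel Pa Pl ⬝ᵥ Pl)
    - V.m * V.g * V.l * (e₃ ⬝ᵥ (A *ᵥ e₃))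

/-- The motions of the vehicle, for all times: `A' = A Ω^`, `b' = A v`,
`Π' = Π × Ω + P × v - mgl Γ × e₃`, `P' = P × Ω`, where `Γ = Aᵀ e₃`. -/
def IsMotion (x : ℝ → Phase) : Prop :=
  ∀ t : ℝ,
    (∀ i j, HasDerivAt (fun s => ((x s).A : Matrix (Fin 3) (Fin 3) ℝ) i j)
      ((((x t).A : Matrix (Fin 3) (Fin 3) ℝ) * hat (V.angVel (x t).ang (x t).lin)) i j) t) ∧
    HasDerivAt (fun s => (x s).b)
      (((x t).A : Matrix (Fin 3) (Fin 3) ℝ) *ᵥ V.vel (x t).ang (x t).lin) t ∧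
    HasDerivAt (fun s => (x s).ang)
      ((x t).ang ⨯₃ V.angVel (x t).ang (x t).lin + (x t).lin ⨯₃ V.vel (x t).ang (x t).lin
        - (V.m * V.g * V.l) • ((((x t).A : Matrix (Fin 3) (Fin 3) ℝ)ᵀ *ᵥ e₃) ⨯₃ e₃)) t ∧
    HasDerivAt (fun s => (x s).lin) ((x t).lin ⨯₃ V.angVel (x t).ang (x t).lin) t

/-- Stability of `x` modulo the symmetry group: motions starting close to `x` exist for all
times and stay in any prescribed invariant neighbourhood of the group orbit of `x`. -/
def IsSymStable (x : Phase) : Prop :=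
  ∀ U : Set Phase, IsOpen U → (∀ (g : Sym), ∀ y ∈ U, g • y ∈ U) → x ∈ U →
    ∃ N ∈ 𝓝 x, ∀ y ∈ N, (∃ γ : ℝ → Phase, V.IsMotion γ ∧ γ 0 = y) ∧
      ∀ γ : ℝ → Phase, V.IsMotion γ → γ 0 = y → ∀ t : ℝ, γ t ∈ U

end Vehicle

/-- The relative equilibrium with linear momentum `P` and spin momentum `S`:
`A = id`, `b = 0`, `Π = S e₃`, `P = P e₃`. -/
def relEq (P S : ℝ) : Phase := ⟨1, 0, S • e₃, P • e₃⟩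

/-- The momentum map of the translations, `A P`. -/
def momTrans (A : Matrix (Fin 3) (Fin 3) ℝ) (Pl : Vec) : Vec := A *ᵥ Pl

/-- The momentum map of the material symmetry, `-Π · e₃`. -/
def momSpin (Pa : Vec) : ℝ := -(Pa ⬝ᵥ e₃)

theorem relEq_velocities (V : Vehicle) (P S : ℝ) :
    V.angVel (relEq P S).ang (relEq P S).lin = (S / V.I₃) • e₃ ∧
      V.vel (relEq P S).ang (relEq P S).lin = (P / V.M₃) • e₃ := by
  constructor <;> ext i <;> fin_cases i <;> simp [relEq, e₃, Vehicle.angVel, Vehicle.vel]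

/-- The curve `exp (t ξ) • x_e`, with `ξ = (0, (P / M₃) e₃, -S / I₃)`, is a motion. -/
theorem relEq_isMotion (V : Vehicle) (P S : ℝ) :
    V.IsMotion fun t => (⟨0, (t * (P / V.M₃)) • e₃, ((-(t * (S / V.I₃)) : ℝ) : Real.Angle)⟩ : Sym)
      • relEq P S := by
  have hA : ∀ t : ℝ, (((⟨0, (t * (P / V.M₃)) • e₃,
      ((-(t * (S / V.I₃)) : ℝ) : Real.Angle)⟩ : Sym) • relEq P S).A :
      Matrix (Fin 3) (Fin 3) ℝ) = rotMat ((t * (S / V.I₃) : ℝ) : Real.Angle) := by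
    intro t
    change (rotMat 0 * 1) * rotMat (-((-(t * (S / V.I₃)) : ℝ) : Real.Angle)) = _
    rw [rotMat_zero, ← Real.Angle.coe_neg, neg_neg, one_mul, one_mul]
  have hb : ∀ t : ℝ, ((⟨0, (t * (P / V.M₃)) • e₃,
      ((-(t * (S / V.I₃)) : ℝ) : Real.Angle)⟩ : Sym) • relEq P S).b = (t * (P / V.M₃)) • e₃ := by
    intro t
    change rotMat 0 *ᵥ (0 : Vec) + _ = _
    simp
  have hang : ∀ t : ℝ, ((⟨0, (t * (P / V.M₃)) • e₃,
      ((-(t * (S / V.I₃)) : ℝ) : Real.Angle)⟩ : Sym) • relEq P S).ang = S • e₃ := by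
    intro t
    change rotMat _ *ᵥ (S • e₃) = _
    ext i; fin_cases i <;> simp [rotMat, e₃]
  have hlin : ∀ t : ℝ, ((⟨0, (t * (P / V.M₃)) • e₃,
      ((-(t * (S / V.I₃)) : ℝ) : Real.Angle)⟩ : Sym) • relEq P S).lin = P • e₃ := by
    intro t
    change rotMat _ *ᵥ (P • e₃) = _
    ext i; fin_cases i <;> simp [rotMat, e₃]
  have hv := relEq_velocities V P S
  have h1 : V.angVel (S • e₃) (P • e₃) = (S / V.I₃) • e₃ := hv.1
  have h2 : V.vel (S • e₃) (P • e₃) = (P / V.M₃) • e₃ := hv.2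
  intro t
  simp only [hA, hb, hang, hlin, h1, h2]
  have hmul : HasDerivAt (fun s : ℝ => s * (S / V.I₃)) (S / V.I₃) t := by
    simpa using (hasDerivAt_id t).mul_const (S / V.I₃)
  refine ⟨?_, ?_, ?_, ?_⟩
  · have hc := hmul.cos
    have hs := hmul.sin
    have hs' := hs.neg
    intro i j
    fin_cases i <;> fin_cases j <;>
      simp [rotMat, hat, e₃, Matrix.mul_apply, Fin.sum_univ_three] <;>
      first
        | exact hasDerivAt_const _ _
        | simpa using hc
        | simpa using hs
        | exact hs'
  · have he : rotMat ((t * (S / V.I₃) : ℝ) : Real.Angle) *ᵥ ((P / V.M₃) • e₃) = (P / V.M₃) • e₃ := by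
      ext i; fin_cases i <;> simp [rotMat, e₃]
    rw [he]
    have h := ((hasDerivAt_id t).mul_const (P / V.M₃)).smul_const e₃
    simpa using h
  · have he : (S • e₃) ⨯₃ ((S / V.I₃) • e₃) + (P • e₃) ⨯₃ ((P / V.M₃) • e₃)
        - (V.m * V.g * V.l) • (((rotMat ((t * (S / V.I₃) : ℝ) : Real.Angle))ᵀ *ᵥ e₃) ⨯₃ e₃)
        = 0 := by
      ext i; fin_cases i <;> simp [rotMat, e₃, cross_apply, Matrix.mulVec, dotProduct,
        Fin.sum_univ_three]
    rw [he]
    exact hasDerivAt_const _ _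
  · have he : (P • e₃) ⨯₃ ((S / V.I₃) • e₃) = 0 := by
      ext i; fin_cases i <;> simp [e₃, cross_apply]
    rw [he]
    exact hasDerivAt_const _ _

/-- The isotropy group of `x_e` is the diagonal `SO(2)`. -/
theorem relEq_isotropy (P S : ℝ) (g : Sym) :
    g • relEq P S = relEq P S ↔ g.a = 0 ∧ g.φ = g.θ := by
  have hA : (g • relEq P S).A = rot g.φ * 1 * rot (-g.θ) := rfl
  have hb : (g • relEq P S).b = rotMat g.φ *ᵥ (0 : Vec) + g.a := rfl
  have hang : (g • relEq P S).ang = rotMat g.θ *ᵥ (S • e₃) := rfl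
  have hlin : (g • relEq P S).lin = rotMat g.θ *ᵥ (P • e₃) := rfl
  constructor
  · intro h
    constructor
    · have h1 := congrArg Phase.b h
      rw [hb] at h1
      simpa [relEq] using h1
    · have h1 := congrArg Phase.A h
      rw [hA, mul_one, ← rot_add] at h1
      have h2 : rotMat (g.φ + -g.θ) = 1 := congrArg Subtype.val h1
      have hc : (g.φ + -g.θ).cos = (0 : Real.Angle).cos := by
        simpa [rotMat] using congrFun (congrFun h2 0) 0
      have hs : (g.φ + -g.θ).sin = (0 : Real.Angle).sin := by
        simpa [rotMat] using congrFun (congrFun h2 1) 0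
      have h3 : g.φ + -g.θ = 0 := by
        generalize g.φ + -g.θ = α at hc hs
        induction α using Real.Angle.induction_on with
        | h x =>
          rw [← Real.Angle.coe_zero] at hc hs ⊢
          exact Real.Angle.cos_sin_inj hc hs
      simpa [add_neg_eq_zero] using h3
  · rintro ⟨ha, hφ⟩
    ext1
    · rw [hA, hφ, mul_one, ← rot_add, add_neg_cancel, rot_zero]; rfl
    · rw [hb, ha]; simp [relEq]
    · rw [hang]; ext i; fin_cases i <;> simp [relEq, rotMat, e₃]
    · rw [hlin]; ext i; fin_cases i <;> simp [relEq, rotMat, e₃]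

/-! ### Reduction by the translations and the material symmetry -/

/-- The coordinates `(q₁, q₂, p₁, p₂)` of the reduced spaces. -/
abbrev Red : Type := Fin 4 → ℝ

/-- The third component `√(1 - q₁² - q₂²)` of `Γ`. -/
def sliceΓ (w : Red) : ℝ := Real.sqrt (1 - w 0 ^ 2 - w 1 ^ 2)

/-- The factor `1 / (1 + √(1 - q₁² - q₂²))`. -/
def sliceF (w : Red) : ℝ := 1 / (1 + sliceΓ w)

/-- The attitude `id + x^ + f (x^)²`, where `x = -e₃ × (q₁, q₂, 0)`. -/
def sliceA (w : Red) : Matrix (Fin 3) (Fin 3) ℝ :=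
  1 + hat (-(e₃ ⨯₃ ![w 0, w 1, 0])) + sliceF w • hat (-(e₃ ⨯₃ ![w 0, w 1, 0])) ^ 2

/-- The linear momentum `Aᵀ ν^a`. -/
def sliceLin (νa : Vec) (w : Red) : Vec := (sliceA w)ᵀ *ᵥ νa

theorem sliceA_entries (w : Red) : sliceA w =
    !![1 - sliceF w * w 0 ^ 2, -(sliceF w * (w 0 * w 1)), -w 0;
      -(sliceF w * (w 0 * w 1)), 1 - sliceF w * w 1 ^ 2, -w 1;
      w 0, w 1, 1 - sliceF w * (w 0 ^ 2 + w 1 ^ 2)] := by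
  ext i j
  fin_cases i <;> fin_cases j <;>
    simp [sliceA, e₃, hat, cross_apply, pow_two] <;>
    first | ring1 | (left; ring1)

theorem sliceA_eq (w : Red) (hw : w 0 ^ 2 + w 1 ^ 2 ≤ 1) : sliceA w =
    !![1 - sliceF w * w 0 ^ 2, -(sliceF w * (w 0 * w 1)), -w 0;
      -(sliceF w * (w 0 * w 1)), 1 - sliceF w * w 1 ^ 2, -w 1;
      w 0, w 1, sliceΓ w] := by
  have h0 : 0 ≤ sliceΓ w := Real.sqrt_nonneg _
  have h1 : sliceΓ w ^ 2 = 1 - w 0 ^ 2 - w 1 ^ 2 := Real.sq_sqrt (by linarith)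
  have h2 : 1 - sliceF w * (w 0 ^ 2 + w 1 ^ 2) = sliceΓ w := by
    have : 1 + sliceΓ w ≠ 0 := by positivity
    rw [sliceF]; field_simp; nlinarith
  rw [sliceA_entries, h2]

theorem sliceA_mem (w : Red) (hw : w 0 ^ 2 + w 1 ^ 2 ≤ 1) :
    sliceA w ∈ Matrix.specialOrthogonalGroup (Fin 3) ℝ := by
  have h0 : 0 ≤ sliceΓ w := Real.sqrt_nonneg _
  have h1 : sliceΓ w ^ 2 = 1 - w 0 ^ 2 - w 1 ^ 2 := Real.sq_sqrt (by linarith)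
  have h3 : sliceF w * (1 + sliceΓ w) = 1 := by
    have : 1 + sliceΓ w ≠ 0 := by positivity
    rw [sliceF]; field_simp
  have h4 : sliceΓ w = 1 - sliceF w * (w 0 ^ 2 + w 1 ^ 2) := by
    linear_combination (1 - sliceΓ w) * h3 + sliceF w * h1
  have h5 : sliceF w ^ 2 * (w 0 ^ 2 + w 1 ^ 2) = 2 * sliceF w - 1 := by
    linear_combination -h3 + sliceF w * h4
  rw [Matrix.mem_specialOrthogonalGroup_iff, Matrix.mem_orthogonalGroup_iff, sliceA_eq w hw]
  constructor
  · ext i j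
    fin_cases i <;> fin_cases j <;>
      simp [Matrix.mul_apply, Fin.sum_univ_three]
    · linear_combination w 0 ^ 2 * h5
    · linear_combination w 0 * w 1 * h5
    · linear_combination -w 0 * h4
    · linear_combination w 0 * w 1 * h5
    · linear_combination w 1 ^ 2 * h5
    · linear_combination -w 1 * h4
    · linear_combination -w 0 * h4
    · linear_combination -w 1 * h4
    · linear_combination h1
  · simp [Matrix.det_fin_three]
    linear_combination h1 - sliceΓ w * h4

namespace Vehicle

variable (V : Vehicle)

/-- The position `ml M⁻¹ q`. -/
def sliceB (w : Red) : Vec := (V.m * V.l / V.M₁) • ![w 0, w 1, 0]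

/-- The angular momentum of the point of the level set with coordinates `(q, p)`: the vector
with third component `-ν^θ` for which `p₁, p₂` are the momenta conjugate to `q₁, q₂`
(see `slice_conjugate`). -/
def sliceAng (νa : Vec) (νθ : ℝ) (w : Red) : Vec :=
  let r₁ := w 3 - sliceF w * w 0 * νθ - V.m * V.l / V.M₁ * νa 1
  let r₂ := -w 2 - sliceF w * w 1 * νθ + V.m * V.l / V.M₁ * νa 0
  ![(1 - sliceF w * w 1 ^ 2) * r₁ + sliceF w * w 0 * w 1 * r₂,
    sliceF w * w 0 * w 1 * r₁ + (1 - sliceF w * w 0 ^ 2) * r₂,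
    -νθ]

/-- The points of the slice have momentum `(ν^a, ν^θ)`. -/
theorem slice_level (νa : Vec) (νθ : ℝ) (w : Red) (hw : w 0 ^ 2 + w 1 ^ 2 ≤ 1) :
    momTrans (sliceA w) (sliceLin νa w) = νa ∧ momSpin (V.sliceAng νa νθ w) = νθ := by
  constructor
  · have h := (Matrix.mem_orthogonalGroup_iff (Fin 3) ℝ).1
      ((Matrix.mem_specialOrthogonalGroup_iff).1 (sliceA_mem w hw)).1
    have h' : sliceA w * (sliceA w)ᵀ = 1 := h
    rw [momTrans, sliceLin, Matrix.mulVec_mulVec, h', Matrix.one_mulVec]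
  · simp [momSpin, sliceAng, e₃, dotProduct, Fin.sum_univ_three]

theorem hasDerivAt_sliceΓ (w : Red) (hw : w 0 ^ 2 + w 1 ^ 2 < 1) :
    HasDerivAt (fun s => sliceΓ (Function.update w 0 s)) (-(w 0 / sliceΓ w)) (w 0) ∧
    HasDerivAt (fun s => sliceΓ (Function.update w 1 s)) (-(w 1 / sliceΓ w)) (w 1) := by
  have hne : 1 - w 0 ^ 2 - w 1 ^ 2 ≠ 0 := by linarith
  constructor
  · have h : HasDerivAt (fun s : ℝ => 1 - s ^ 2 - w 1 ^ 2) (-(2 * w 0)) (w 0) := by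
      simpa using (((hasDerivAt_id (w 0)).pow 2).const_sub 1).sub_const (w 1 ^ 2)
    have h' := h.sqrt hne
    simp only [sliceΓ, Function.update_self, Function.update_of_ne (show (1 : Fin 4) ≠ 0 by decide)]
    convert h' using 1
    rw [← sliceΓ, neg_div, mul_div_mul_left _ _ two_ne_zero]
  · have h : HasDerivAt (fun s : ℝ => 1 - w 0 ^ 2 - s ^ 2) (-(2 * w 1)) (w 1) := by
      simpa using ((hasDerivAt_id (w 1)).pow 2).const_sub (1 - w 0 ^ 2)
    have h' := h.sqrt hne
    simp only [sliceΓ, Function.update_self, Function.update_of_ne (show (0 : Fin 4) ≠ 1 by decide)]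
    convert h' using 1
    rw [← sliceΓ, neg_div, mul_div_mul_left _ _ two_ne_zero]

theorem hasDerivAt_sliceF (w : Red) (k : Fin 4) (d : ℝ)
    (h : HasDerivAt (fun s => sliceΓ (Function.update w k s)) d (w k)) :
    HasDerivAt (fun s => sliceF (Function.update w k s)) (-d / (1 + sliceΓ w) ^ 2) (w k) := by
  have h0 : 0 ≤ sliceΓ w := Real.sqrt_nonneg _
  have hne : 1 + sliceΓ w ≠ 0 := by positivity
  have h1 := (h.const_add 1).fun_inv (by simpa using hne)
  simpa [sliceF, one_div] using h1

theorem hasDerivAt_sliceA₀ (w : Red) (hw : w 0 ^ 2 + w 1 ^ 2 < 1) (i j : Fin 3) :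
    HasDerivAt (fun s => sliceA (Function.update w 0 s) i j)
      ((sliceA w * hat ![w 0 * w 1 / (sliceΓ w * (1 + sliceΓ w)),
        -1 - w 0 ^ 2 / (sliceΓ w * (1 + sliceΓ w)), sliceF w * w 1]) i j) (w 0) := by
  have hpos : 0 < sliceΓ w := Real.sqrt_pos.2 (by linarith)
  have hsq : sliceΓ w ^ 2 = 1 - w 0 ^ 2 - w 1 ^ 2 := Real.sq_sqrt (by linarith)
  have hf : sliceF w = 1 / (1 + sliceΓ w) := rfl
  have hF := hasDerivAt_sliceF w 0 _ (hasDerivAt_sliceΓ w hw).1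
  have hid : HasDerivAt (fun s : ℝ => s) 1 (w 0) := hasDerivAt_id (w 0)
  rw [sliceA_eq w hw.le]
  simp only [sliceA_entries, Function.update_self, Function.update_of_ne (show (1 : Fin 4) ≠ 0 by decide)]
  fin_cases i <;> fin_cases j <;>
    simp only [hat, Matrix.mul_apply, Fin.sum_univ_three] <;> simp
  · refine ((hF.mul (hid.pow 2)).const_sub 1).congr_deriv ?_
    simp [hf]
    field_simp
    grind
  · refine ((hF.mul (hid.mul_const (w 1))).neg).congr_deriv ?_
    simp [hf]
    field_simp
    grind
  · refine (hid.neg).congr_deriv ?_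
    simp [hf]
    field_simp
    grind
  · refine ((hF.mul (hid.mul_const (w 1))).neg).congr_deriv ?_
    simp [hf]
    field_simp
    grind
  · refine ((hF.mul_const (w 1 ^ 2)).const_sub 1).congr_deriv ?_
    simp [hf]
    field_simp
    grind
  · refine (hasDerivAt_const (w 0) (-w 1)).congr_deriv ?_
    simp [hf]
    field_simp
    grind
  · refine (hid).congr_deriv ?_
    simp [hf]
    field_simp
    grind
  · refine (hasDerivAt_const (w 0) (w 1)).congr_deriv ?_
    simp [hf]
    field_simp
    grind
  · refine ((hF.mul ((hid.pow 2).add_const (w 1 ^ 2))).const_sub 1).congr_deriv ?_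
    simp [hf]
    field_simp
    grind

theorem hasDerivAt_sliceA₁ (w : Red) (hw : w 0 ^ 2 + w 1 ^ 2 < 1) (i j : Fin 3) :
    HasDerivAt (fun s => sliceA (Function.update w 1 s) i j)
      ((sliceA w * hat ![1 + w 1 ^ 2 / (sliceΓ w * (1 + sliceΓ w)),
        -(w 0 * w 1 / (sliceΓ w * (1 + sliceΓ w))), -(sliceF w * w 0)]) i j) (w 1) := by
  have hpos : 0 < sliceΓ w := Real.sqrt_pos.2 (by linarith)
  have hsq : sliceΓ w ^ 2 = 1 - w 0 ^ 2 - w 1 ^ 2 := Real.sq_sqrt (by linarith)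
  have hf : sliceF w = 1 / (1 + sliceΓ w) := rfl
  have hF := hasDerivAt_sliceF w 1 _ (hasDerivAt_sliceΓ w hw).2
  have hid : HasDerivAt (fun s : ℝ => s) 1 (w 1) := hasDerivAt_id (w 1)
  rw [sliceA_eq w hw.le]
  simp only [sliceA_entries, Function.update_self, Function.update_of_ne (show (0 : Fin 4) ≠ 1 by decide)]
  fin_cases i <;> fin_cases j <;>
    simp only [hat, Matrix.mul_apply, Fin.sum_univ_three] <;> simp
  · refine ((hF.mul_const (w 0 ^ 2)).const_sub 1).congr_deriv ?_
    simp [hf]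
    field_simp
    grind
  · refine ((hF.mul (hid.const_mul (w 0))).neg).congr_deriv ?_
    simp [hf]
    field_simp
    grind
  · refine (hasDerivAt_const (w 1) (-w 0)).congr_deriv ?_
    simp [hf]
    field_simp
    grind
  · refine ((hF.mul (hid.const_mul (w 0))).neg).congr_deriv ?_
    simp [hf]
    field_simp
    grind
  · refine ((hF.mul (hid.pow 2)).const_sub 1).congr_deriv ?_
    simp [hf]
    field_simp
    grind
  · refine (hid.neg).congr_deriv ?_
    simp [hf]
    field_simp
    grind
  · refine (hasDerivAt_const (w 1) (w 0)).congr_deriv ?_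
    simp [hf]
    field_simp
    grind
  · refine (hid).congr_deriv ?_
    simp [hf]
    field_simp
    grind
  · refine ((hF.mul ((hid.pow 2).const_add (w 0 ^ 2))).const_sub 1).congr_deriv ?_
    simp [hf]
    field_simp
    grind

theorem hasDerivAt_sliceB₀ (w : Red) :
    HasDerivAt (fun s => V.sliceB (Function.update w 0 s)) ((V.m * V.l / V.M₁) • ![1, 0, 0]) (w 0) := by
  have hid : HasDerivAt (fun s : ℝ => s * (V.m * V.l / V.M₁)) (V.m * V.l / V.M₁) (w 0) := by
    simpa using (hasDerivAt_id (w 0)).mul_const (V.m * V.l / V.M₁)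
  have h := (hid.smul_const (![1, 0, 0] : Vec)).add_const
    ((V.m * V.l / V.M₁ * w 1) • (![0, 1, 0] : Vec))
  refine (h.congr_of_eventuallyEq (.of_forall fun s => ?_))
  ext i
  fin_cases i <;> simp [sliceB, mul_comm]

theorem hasDerivAt_sliceB₁ (w : Red) :
    HasDerivAt (fun s => V.sliceB (Function.update w 1 s)) ((V.m * V.l / V.M₁) • ![0, 1, 0]) (w 1) := by
  have hid : HasDerivAt (fun s : ℝ => s * (V.m * V.l / V.M₁)) (V.m * V.l / V.M₁) (w 1) := by
    simpa using (hasDerivAt_id (w 1)).mul_const (V.m * V.l / V.M₁)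
  have h := (hid.smul_const (![0, 1, 0] : Vec)).add_const
    ((V.m * V.l / V.M₁ * w 0) • (![1, 0, 0] : Vec))
  refine (h.congr_of_eventuallyEq (.of_forall fun s => ?_))
  ext i
  fin_cases i <;> simp [sliceB, mul_comm]

/-- The coordinates `p₁, p₂` are the momenta conjugate to `q₁, q₂` on the slice: if
`Aᵀ ∂A/∂q_i = ω_i^` then `p_i = ω_i · Π + (Aᵀ ∂b/∂q_i) · P`. -/
theorem slice_conjugate (νa : Vec) (νθ : ℝ) (w : Red) (hw : w 0 ^ 2 + w 1 ^ 2 < 1) :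
    (∃ ω β : Vec,
      (∀ i j, HasDerivAt (fun s => sliceA (Function.update w 0 s) i j)
        ((sliceA w * hat ω) i j) (w 0)) ∧
      HasDerivAt (fun s => V.sliceB (Function.update w 0 s)) β (w 0) ∧
      w 2 = ω ⬝ᵥ V.sliceAng νa νθ w + ((sliceA w)ᵀ *ᵥ β) ⬝ᵥ sliceLin νa w) ∧
    (∃ ω β : Vec,
      (∀ i j, HasDerivAt (fun s => sliceA (Function.update w 1 s) i j)
        ((sliceA w * hat ω) i j) (w 1)) ∧
      HasDerivAt (fun s => V.sliceB (Function.update w 1 s)) β (w 1) ∧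
      w 3 = ω ⬝ᵥ V.sliceAng νa νθ w + ((sliceA w)ᵀ *ᵥ β) ⬝ᵥ sliceLin νa w) := by
  have hpos : 0 < sliceΓ w := Real.sqrt_pos.2 (by linarith)
  have hsq : sliceΓ w ^ 2 = 1 - w 0 ^ 2 - w 1 ^ 2 := Real.sq_sqrt (by linarith)
  have hf : sliceF w = 1 / (1 + sliceΓ w) := rfl
  have hβ : ∀ β : Vec, ((sliceA w)ᵀ *ᵥ β) ⬝ᵥ sliceLin νa w = β ⬝ᵥ νa := by
    intro β
    have h := (Matrix.mem_orthogonalGroup_iff (Fin 3) ℝ).1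
      ((Matrix.mem_specialOrthogonalGroup_iff).1 (sliceA_mem w hw.le)).1
    have h' : sliceA w * (sliceA w)ᵀ = 1 := h
    rw [sliceLin, Matrix.mulVec_transpose, ← Matrix.dotProduct_mulVec, Matrix.mulVec_mulVec, h',
      Matrix.one_mulVec]
  constructor
  · refine ⟨_, _, hasDerivAt_sliceA₀ w hw, V.hasDerivAt_sliceB₀ w, ?_⟩
    rw [hβ]
    simp [sliceAng, dotProduct, Fin.sum_univ_three, hf]
    field_simp
    grind
  · refine ⟨_, _, hasDerivAt_sliceA₁ w hw, V.hasDerivAt_sliceB₁ w, ?_⟩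
    rw [hβ]
    simp [sliceAng, dotProduct, Fin.sum_univ_three, hf]
    field_simp
    grind

/-- The Hamiltonian of the reduced system at momentum `ν = (ν^a, ν^θ)`. -/
def redH (νa : Vec) (νθ : ℝ) (w : Red) : ℝ :=
  V.energy (sliceA w) (V.sliceAng νa νθ w) (sliceLin νa w)

/-- The reduced Hamiltonian is smooth on the domain of the slice. -/
theorem contDiffAt_redH (νa : Vec) (νθ : ℝ) (w : Red) (hw : w 0 ^ 2 + w 1 ^ 2 < 1) :
    ContDiffAt ℝ (⊤ : ℕ∞) (V.redH νa νθ) w := by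
  have hc : ∀ i : Fin 4, ContDiffAt ℝ (⊤ : ℕ∞) (fun u : Red => u i) w := fun i =>
    (contDiff_apply ℝ ℝ i).contDiffAt
  have hΓ : ContDiffAt ℝ (⊤ : ℕ∞) sliceΓ w :=
    ((contDiffAt_const.sub ((hc 0).pow 2)).sub ((hc 1).pow 2)).sqrt (by linarith)
  have hF : ContDiffAt ℝ (⊤ : ℕ∞) sliceF w :=
    contDiffAt_const.div (contDiffAt_const.add hΓ) (by
      have : 0 ≤ sliceΓ w := Real.sqrt_nonneg _
      positivity)
  have hA : ∀ i j, ContDiffAt ℝ (⊤ : ℕ∞) (fun u => sliceA u i j) w := by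
    intro i j
    have h0 := hc 0
    have h1 := hc 1
    fin_cases i <;> fin_cases j <;>
      simp [sliceA, e₃, hat, cross_apply, pow_two] <;> fun_prop
  have hl : ∀ i, ContDiffAt ℝ (⊤ : ℕ∞) (fun u => sliceLin νa u i) w := by
    intro i
    simp only [sliceLin, Matrix.mulVec, dotProduct, Fin.sum_univ_three, Matrix.transpose_apply]
    have h0 := hA 0 i
    have h1 := hA 1 i
    have h2 := hA 2 i
    fun_prop
  have ha : ∀ i, ContDiffAt ℝ (⊤ : ℕ∞) (fun u => V.sliceAng νa νθ u i) w := by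
    intro i
    have h0 := hc 0
    have h1 := hc 1
    have h2 := hc 2
    have h3 := hc 3
    fin_cases i <;> simp [sliceAng] <;> fun_prop
  unfold redH energy angVel vel
  simp only [dotProduct, Fin.sum_univ_three, Matrix.mulVec, e₃]
  simp
  have h0 := ha 0
  have h1 := ha 1
  have h2 := ha 2
  have k0 := hl 0
  have k1 := hl 1
  have k2 := hl 2
  have k3 := hA 2 2
  fun_prop

end Vehicle

/-- The point of the slice with coordinates `0`, at the momentum of `x_e`, is `x_e`. -/
theorem slice_relEq (V : Vehicle) (P S : ℝ) :
    sliceA 0 = (relEq P S).A ∧ V.sliceB 0 = (relEq P S).b ∧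
      V.sliceAng (momTrans (relEq P S).A (relEq P S).lin) (momSpin (relEq P S).ang) 0
        = (relEq P S).ang ∧
      sliceLin (momTrans (relEq P S).A (relEq P S).lin) 0 = (relEq P S).lin := by
  have h : sliceA 0 = 1 := by
    rw [sliceA_eq 0 (by simp)]
    ext i j; fin_cases i <;> fin_cases j <;> simp [sliceΓ]
  have hA : ((relEq P S).A : Matrix (Fin 3) (Fin 3) ℝ) = 1 := rfl
  refine ⟨h, ?_, ?_, ?_⟩
  · ext i; fin_cases i <;> simp [Vehicle.sliceB, relEq]
  · ext i; fin_cases i <;> simp [Vehicle.sliceAng, momTrans, momSpin, relEq, e₃]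
  · rw [sliceLin, h, momTrans, hA]; simp

/-! ### Stability notions of the reduced system -/

/-- The Hessian matrix at `0` of a function of the reduced coordinates. -/
def hessian (h : Red → ℝ) : Matrix (Fin 4) (Fin 4) ℝ :=
  Matrix.of fun i j =>
    fderiv ℝ (fun w => fderiv ℝ h w (Pi.single j 1)) 0 (Pi.single i 1)

/-- The standard symplectic structure matrix in the coordinates `(q₁, q₂, p₁, p₂)`. -/
def sympJ : Matrix (Fin 4) (Fin 4) ℝ :=
  !![0, 0, 1, 0; 0, 0, 0, 1; -1, 0, 0, 0; 0, -1, 0, 0]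

namespace Vehicle

variable (V : Vehicle)

/-- The Hamiltonian of the reduced system at the momentum of the relative equilibrium. -/
def redHe (P S : ℝ) : Red → ℝ :=
  V.redH (momTrans (relEq P S).A (relEq P S).lin) (momSpin (relEq P S).ang)

/-- Energy-momentum confinement: `0` is an equilibrium of the reduced system and the Hessian of
the reduced Hamiltonian there is definite. -/
def IsEMConfined (P S : ℝ) : Prop :=
  fderiv ℝ (V.redHe P S) 0 = 0 ∧
    ((hessian (V.redHe P S)).PosDef ∨ (-hessian (V.redHe P S)).PosDef)

/-- Spectral stability: all the eigenvalues of the linearization of the reduced Hamiltonian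
system `w' = J ∇H(w)` at its equilibrium `0` lie on the imaginary axis. -/
def IsSpectrallyStable (P S : ℝ) : Prop :=
  fderiv ℝ (V.redHe P S) 0 = 0 ∧
    ∀ z ∈ spectrum ℂ ((sympJ * hessian (V.redHe P S)).map (algebraMap ℝ ℂ)), z.re = 0

end Vehicle

end Kirchhoff

end

/-!
The attitude enters the equations of `Π` and `P` only through the vertical direction `Γ = Aᵀ e₃`
seen from the body, and the rotations of space about the vertical together with the translations
act transitively on the pairs `(A, b)` with the same `Γ`. Hence closeness to the orbit of the relative equilibrium is closeness of `(Γ, Π, P)` to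
`(e₃, S e₃, P e₃)` (`invariant_mem_of_body_near`).

*Nonlinear stability.* The functions `|Γ|²`, `P · Γ`, `|P|²`, `Π₃` and the energy are conserved. On
their common level set through the relative equilibrium the first three give `P = P_e Γ`, and the
energy balance becomes a sum of nonnegative terms once `Γ₃` is close to `1`, provided that
`mgl > (1 / M₃ - 1 / M₁) P_e²`; so the relative equilibrium is isolated in its level set
(`Vehicle.isolated_relEq`). A continuous curve that starts near an isolated point of a level set
and conserves the level function cannot cross a small sphere (`confined_of_isolated_level`). No
second derivatives are needed here, and nearby values of the momentum are covered as well.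

*Motions for all times.* Multiplying a vector field by a scalar function does not change its first
integrals, so the solutions of the equations cut off outside a large ball obey the same a priori
bounds as the true motions. The cut-off field is bounded and Lipschitz, hence complete, and its
solutions never reach the region where the cut-off acts
(`exists_isIntegralCurve_of_bounded_rescalings`, `Vehicle.exists_isMotion`).

*The reduced system.* The gradient of the reduced Hamiltonian is `M(w) w` with an explicit symmetric
matrix `M(w)` (`Vehicle.fderiv_redHe`), so `w = 0` is critical and the Hessian there is `M(0)`, a
matrix with four parameters `a, N, β, σ` (`Vehicle.hessianForm`). Completing the square shows that
it is positive definite if `a > 0` and `a N - β² - σ² > 0`. The eigenvalues of the linearization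
satisfy `(z ∓ iσ)² = -(a N - β²)`, so they are imaginary if `a N - β² > 0`. Since
`a = M₁ / Δ` and `σ = a S / 2`, these are the two inequalities of the theorem.
-/

noncomputable section

namespace Kirchhoff

/-! ### Global solutions of differential equations -/

section ODE

variable {E : Type*} [NormedAddCommGroup E] [NormedSpace ℝ E]

/-- A bounded, globally Lipschitz vector field is complete: on a time interval `[-T, T]` the
Picard-Lindelöf theorem applies in a ball of radius `L T`, and the solutions for different `T`
fit together by uniqueness. -/
theorem exists_isIntegralCurve_of_lipschitzWith_of_bounded [CompleteSpace E] {f : E → E}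
    {K L : NNReal} (hK : LipschitzWith K f) (hL : ∀ x, ‖f x‖ ≤ L) (x₀ : E) :
    ∃ γ : ℝ → E, γ 0 = x₀ ∧ ∀ t, HasDerivAt γ (f (γ t)) t := by
  have hloc : ∀ n : ℕ, ∃ γ : ℝ → E, γ 0 = x₀ ∧
      ∀ t ∈ Set.Icc (-(n + 1 : ℝ)) (n + 1),
        HasDerivWithinAt γ (f (γ t)) (Set.Icc (-(n + 1 : ℝ)) (n + 1)) t := by
    intro n
    have h0 : (0 : ℝ) ∈ Set.Icc (-(n + 1 : ℝ)) (n + 1) := by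
      constructor <;> linarith [(Nat.cast_nonneg n : (0 : ℝ) ≤ n)]
    have hp : IsPicardLindelof (fun _ => f) (⟨0, h0⟩ : Set.Icc (-(n + 1 : ℝ)) (n + 1)) x₀
        (L * (n + 1)) 0 L K :=
      IsPicardLindelof.of_time_independent (fun x _ => hL x) hK.lipschitzOnWith (by simp)
    exact hp.exists_eq_forall_mem_Icc_hasDerivWithinAt₀
  choose γ h0 hγ using hloc
  have hder : ∀ n : ℕ, ∀ t ∈ Set.Ioo (-(n + 1 : ℝ)) (n + 1),
      HasDerivAt (γ n) (f (γ n t)) t := fun n t ht =>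
    (hγ n t (Set.Ioo_subset_Icc_self ht)).hasDerivAt (Icc_mem_nhds ht.1 ht.2)
  have heq : ∀ m n : ℕ, m ≤ n → ∀ t ∈ Set.Ioo (-(m + 1 : ℝ)) (m + 1), γ n t = γ m t := by
    intro m n hmn t ht
    have hc : (m : ℝ) ≤ n := by exact_mod_cast hmn
    refine ODE_solution_unique_of_mem_Ioo (v := fun _ => f) (s := fun _ => Set.univ) (K := K)
      (t₀ := 0) (a := -(m + 1 : ℝ)) (b := m + 1) (fun _ _ => hK.lipschitzOnWith) ?_ ?_ ?_
      ((h0 n).trans (h0 m).symm) ht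
    · constructor <;> linarith [(Nat.cast_nonneg m : (0 : ℝ) ≤ m)]
    · exact fun s hs => ⟨hder n s ⟨by linarith [hs.1], by linarith [hs.2]⟩, trivial⟩
    · exact fun s hs => ⟨hder m s hs, trivial⟩
  have hmem : ∀ t : ℝ, t ∈ Set.Ioo (-((⌈|t|⌉₊ : ℝ) + 1)) ((⌈|t|⌉₊ : ℝ) + 1) := by
    intro t
    have := Nat.le_ceil |t|
    exact abs_lt.1 (by linarith)
  -- at the time `t` the solution on `[-(n + 1), n + 1]` with `n = ⌈|t|⌉` is used, which has `t` in
  -- the interior of its domain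
  refine ⟨fun t => γ ⌈|t|⌉₊ t, h0 _, fun t => ?_⟩
  refine (hder _ t (hmem t)).congr_of_eventuallyEq ?_
  filter_upwards [isOpen_Ioo.mem_nhds (hmem t)] with s hs
  rcases le_total ⌈|s|⌉₊ ⌈|t|⌉₊ with h | h
  · exact (heq _ _ h s (hmem s)).symm
  · exact heq _ _ h s hs

/-- If every time-rescaled solution `γ' = c • f(γ)` through `x₀` stays in a fixed bounded set, then
the solution of `x' = f(x)` through `x₀` exists for all times. The a priori bound is asked for
all rescalings because it is applied to `f` multiplied by a cut-off function. -/
theorem exists_isIntegralCurve_of_bounded_rescalings [FiniteDimensional ℝ E] {f : E → E}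
    (hf : ContDiff ℝ 1 f) (x₀ : E) (R : ℝ)
    (hR : ∀ (c : ℝ → ℝ) (γ : ℝ → E), γ 0 = x₀ → (∀ t, HasDerivAt γ (c t • f (γ t)) t) →
      ∀ t, ‖γ t‖ ≤ R) :
    ∃ γ : ℝ → E, γ 0 = x₀ ∧ ∀ t, HasDerivAt γ (f (γ t)) t := by
  have : CompleteSpace E := FiniteDimensional.complete ℝ E
  have hpos : 0 < |R| + 1 := by positivity
  let χ : ContDiffBump (0 : E) := ⟨|R| + 1, |R| + 2, hpos, by linarith⟩
  -- the solutions of the cut-off field are rescaled solutions with the factor `χ(γ t)`, so they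
  -- stay where `χ = 1`
  have hsm : ContDiff ℝ 1 fun x => χ x • f x := χ.contDiff.smul hf
  have hcs : HasCompactSupport fun x => χ x • f x := χ.hasCompactSupport.smul_right
  obtain ⟨K, hK⟩ := hsm.lipschitzWith_of_hasCompactSupport hcs one_ne_zero
  obtain ⟨L, hL⟩ := hcs.exists_bound_of_continuous hsm.continuous
  obtain ⟨γ, h0, hγ⟩ := exists_isIntegralCurve_of_lipschitzWith_of_bounded (L := L.toNNReal) hK
    (fun x => (hL x).trans (Real.le_coe_toNNReal L)) x₀
  refine ⟨γ, h0, fun t => ?_⟩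
  have hb := hR (fun t => χ (γ t)) γ h0 hγ t
  have h1 : χ (γ t) = 1 := χ.one_of_mem_closedBall (by
    rw [mem_closedBall_zero_iff]
    exact hb.trans ((le_abs_self R).trans (by simp [χ])))
  simpa [h1] using hγ t

end ODE

/-- Topological form of the energy-Casimir method: if `x₀` is isolated in its level set of the
continuous map `Φ`, then curves that conserve `Φ` and start close to `x₀` stay close to `x₀`.
Indeed `Φ` maps a small sphere around `x₀` to a compact set that misses `Φ x₀`, and a curve which
starts inside cannot cross the sphere if its value of `Φ` is not in that set. -/
theorem confined_of_isolated_level {X Y : Type*} [PseudoMetricSpace X] [ProperSpace X]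
    [TopologicalSpace Y] [T2Space Y] {Φ : X → Y} (hΦ : Continuous Φ) {x₀ : X}
    (hiso : ∀ᶠ x in 𝓝 x₀, Φ x = Φ x₀ → dist x x₀ = 0) {W : Set X} (hW : W ∈ 𝓝 x₀) :
    ∃ N ∈ 𝓝 x₀, ∀ γ : ℝ → X, Continuous γ → γ 0 ∈ N → (∀ t, Φ (γ t) = Φ (γ 0)) →
      ∀ t, γ t ∈ W := by
  obtain ⟨r, hr, hsub⟩ := Metric.nhds_basis_closedBall.mem_iff.1 (Filter.inter_mem hiso hW)
  have hcomp : IsCompact (Φ '' Metric.sphere x₀ r) := (isCompact_sphere x₀ r).image hΦ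
  have hmiss : Φ x₀ ∉ Φ '' Metric.sphere x₀ r := by
    rintro ⟨x, hx, hxe⟩
    have h1 := (hsub (Metric.sphere_subset_closedBall hx)).1 hxe
    rw [Metric.mem_sphere] at hx
    linarith
  refine ⟨Metric.ball x₀ r ∩ Φ ⁻¹' (Φ '' Metric.sphere x₀ r)ᶜ,
    Filter.inter_mem (Metric.ball_mem_nhds x₀ hr)
      (hΦ.continuousAt.preimage_mem_nhds (hcomp.isClosed.isOpen_compl.mem_nhds hmiss)), ?_⟩
  rintro γ hγ ⟨hb, hn⟩ hcons t
  have hd : Continuous fun s => dist (γ s) x₀ := hγ.dist continuous_const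
  have hlt : dist (γ t) x₀ < r := by
    by_contra! hge
    obtain ⟨s, hs⟩ := mem_range_of_exists_le_of_exists_ge hd ⟨0, (Metric.mem_ball.1 hb).le⟩
      ⟨t, hge⟩
    exact hn ⟨γ s, hs, hcons s⟩
  exact (hsub (Metric.mem_closedBall.2 hlt.le)).2

/-! ### First integrals -/

theorem hasDerivAt_dotProduct {u w : ℝ → Vec} {u' w' : Vec} {t : ℝ} (hu : HasDerivAt u u' t)
    (hw : HasDerivAt w w' t) :
    HasDerivAt (fun s => u s ⬝ᵥ w s) (u' ⬝ᵥ w t + u t ⬝ᵥ w') t := by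
  rw [hasDerivAt_pi] at hu hw
  have h := ((hu 0).mul (hw 0)).add (((hu 1).mul (hw 1)).add ((hu 2).mul (hw 2)))
  refine (h.congr_of_eventuallyEq (.of_forall fun s => ?_)).congr_deriv ?_
  · simp [dotProduct, Fin.sum_univ_three, add_assoc]
  · simp [dotProduct, Fin.sum_univ_three]; ring

theorem eq_of_hasDerivAt_zero {f : ℝ → ℝ} (h : ∀ t, HasDerivAt f 0 t) (t : ℝ) : f t = f 0 :=
  is_const_of_deriv_eq_zero (fun s => (h s).differentiableAt) (fun s => (h s).deriv) t 0

/-- Vectors that are fixed in space, seen from the body, keep their scalar products. -/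
theorem dotProduct_conserved {u w Ω : ℝ → Vec} {c : ℝ → ℝ}
    (hu : ∀ t, HasDerivAt u (c t • (u t ⨯₃ Ω t)) t)
    (hw : ∀ t, HasDerivAt w (c t • (w t ⨯₃ Ω t)) t) (t : ℝ) :
    u t ⬝ᵥ w t = u 0 ⬝ᵥ w 0 := by
  refine eq_of_hasDerivAt_zero (f := fun s => u s ⬝ᵥ w s) (fun s => ?_) t
  refine (hasDerivAt_dotProduct (hu s) (hw s)).congr_deriv ?_
  simp [dotProduct, Fin.sum_univ_three, cross_apply]; ring

/-- Vectors that are fixed in space, seen from the body, keep their triple product. -/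
theorem tripleProduct_conserved {u v w Ω : ℝ → Vec} {c : ℝ → ℝ}
    (hu : ∀ t, HasDerivAt u (c t • (u t ⨯₃ Ω t)) t)
    (hv : ∀ t, HasDerivAt v (c t • (v t ⨯₃ Ω t)) t)
    (hw : ∀ t, HasDerivAt w (c t • (w t ⨯₃ Ω t)) t) (t : ℝ) :
    u t ⬝ᵥ (v t ⨯₃ w t) = u 0 ⬝ᵥ (v 0 ⨯₃ w 0) := by
  refine eq_of_hasDerivAt_zero (f := fun s => u s ⬝ᵥ (v s ⨯₃ w s)) (fun s => ?_) t
  have hvw : HasDerivAt (fun s => v s ⨯₃ w s)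
      ((c s • (v s ⨯₃ Ω s)) ⨯₃ w s + v s ⨯₃ (c s • (w s ⨯₃ Ω s))) s := by
    have h1 := hasDerivAt_pi.1 (hv s)
    have h2 := hasDerivAt_pi.1 (hw s)
    rw [hasDerivAt_pi]
    intro i
    fin_cases i
    · refine ((((h1 1).mul (h2 2)).sub ((h1 2).mul (h2 1))).congr_of_eventuallyEq
        (.of_forall fun s => by simp [cross_apply])).congr_deriv ?_
      simp [cross_apply]; ring
    · refine ((((h1 2).mul (h2 0)).sub ((h1 0).mul (h2 2))).congr_of_eventuallyEq
        (.of_forall fun s => by simp [cross_apply])).congr_deriv ?_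
      simp [cross_apply]; ring
    · refine ((((h1 0).mul (h2 1)).sub ((h1 1).mul (h2 0))).congr_of_eventuallyEq
        (.of_forall fun s => by simp [cross_apply])).congr_deriv ?_
      simp [cross_apply]; ring
  refine (hasDerivAt_dotProduct (hu s) hvw).congr_deriv ?_
  simp [dotProduct, Fin.sum_univ_three, cross_apply]; ring

namespace Vehicle

variable (V : Vehicle)

/-- The Hamiltonian as a function of the body momenta and of the vertical direction `Γ = Aᵀ e₃`
seen from the body. -/
def reducedEnergy (Γ Pa Pl : Vec) : ℝ :=
  1 / 2 * (V.angVel Pa Pl ⬝ᵥ Pa) + 1 / 2 * (V.vel Pa Pl ⬝ᵥ Pl) - V.m * V.g * V.l * Γ 2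

/-- The equations of motion of `Γ, Π, P`, in a time that runs at the speed `c`. -/
structure IsRescaledMotion (c : ℝ → ℝ) (Γ Pa Pl : ℝ → Vec) : Prop where
  vert : ∀ t, HasDerivAt Γ (c t • (Γ t ⨯₃ V.angVel (Pa t) (Pl t))) t
  ang : ∀ t, HasDerivAt Pa (c t • (Pa t ⨯₃ V.angVel (Pa t) (Pl t) + Pl t ⨯₃ V.vel (Pa t) (Pl t)
    - (V.m * V.g * V.l) • (Γ t ⨯₃ e₃))) t
  lin : ∀ t, HasDerivAt Pl (c t • (Pl t ⨯₃ V.angVel (Pa t) (Pl t))) t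

theorem hasDerivAt_velocities {Pa Pl : ℝ → Vec} {Pa' Pl' : Vec} {t : ℝ}
    (hPa : HasDerivAt Pa Pa' t) (hPl : HasDerivAt Pl Pl' t) :
    HasDerivAt (fun s => V.angVel (Pa s) (Pl s)) (V.angVel Pa' Pl') t ∧
      HasDerivAt (fun s => V.vel (Pa s) (Pl s)) (V.vel Pa' Pl') t := by
  have ha := hasDerivAt_pi.1 hPa
  have hl := hasDerivAt_pi.1 hPl
  constructor <;> rw [hasDerivAt_pi] <;> intro i <;> fin_cases i
  · exact (((ha 0).const_mul V.M₁).add ((hl 1).const_mul (V.m * V.l))).div_const V.Δ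
  · exact (((ha 1).const_mul V.M₁).sub ((hl 0).const_mul (V.m * V.l))).div_const V.Δ
  · exact (ha 2).div_const V.I₃
  · exact (((hl 0).const_mul V.I₁).sub ((ha 1).const_mul (V.m * V.l))).div_const V.Δ
  · exact (((hl 1).const_mul V.I₁).add ((ha 0).const_mul (V.m * V.l))).div_const V.Δ
  · exact (hl 2).div_const V.M₃

variable {V}

/-- The spin momentum is conserved because the body is axisymmetric. -/
theorem IsRescaledMotion.spin {c : ℝ → ℝ} {Γ Pa Pl : ℝ → Vec}
    (h : V.IsRescaledMotion c Γ Pa Pl) (t : ℝ) : Pa t 2 = Pa 0 2 := by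
  refine eq_of_hasDerivAt_zero (f := fun s => Pa s 2) (fun s => ?_) t
  refine (hasDerivAt_pi.1 (h.ang s) 2).congr_deriv ?_
  simp [cross_apply, angVel, vel, e₃]; ring_nf; simp

theorem IsRescaledMotion.energy {c : ℝ → ℝ} {Γ Pa Pl : ℝ → Vec}
    (h : V.IsRescaledMotion c Γ Pa Pl) (t : ℝ) :
    V.reducedEnergy (Γ t) (Pa t) (Pl t) = V.reducedEnergy (Γ 0) (Pa 0) (Pl 0) := by
  refine eq_of_hasDerivAt_zero (f := fun s => V.reducedEnergy (Γ s) (Pa s) (Pl s))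
    (fun s => ?_) t
  have hv := hasDerivAt_pi.1 (h.vert s)
  obtain ⟨hΩ, hvel⟩ := hasDerivAt_velocities V (h.ang s) (h.lin s)
  have h1 := (hasDerivAt_dotProduct hΩ (h.ang s)).const_mul (1 / 2 : ℝ)
  have h2 := (hasDerivAt_dotProduct hvel (h.lin s)).const_mul (1 / 2 : ℝ)
  refine ((h1.add h2).sub ((hv 2).const_mul (V.m * V.g * V.l))).congr_deriv ?_
  simp [cross_apply, angVel, vel, e₃, dotProduct, Fin.sum_univ_three]; ring

/-! ### A priori bounds and motions for all times -/

/-- The kinetic energy after completing the square in the angular momentum. -/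
theorem reducedEnergy_eq (hΔ : V.Δ ≠ 0) (hM : V.M₁ ≠ 0) (Γ Pa Pl : Vec) :
    2 * V.reducedEnergy Γ Pa Pl = V.M₁ / V.Δ * ((Pa 0 + V.m * V.l / V.M₁ * Pl 1) ^ 2
      + (Pa 1 - V.m * V.l / V.M₁ * Pl 0) ^ 2) + (Pl 0 ^ 2 + Pl 1 ^ 2) / V.M₁
      + Pa 2 ^ 2 / V.I₃ + Pl 2 ^ 2 / V.M₃ - 2 * (V.m * V.g * V.l) * Γ 2 := by
  have hI : V.I₁ = (V.Δ + V.m ^ 2 * V.l ^ 2) / V.M₁ := by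
    rw [eq_div_iff hM, Δ]; ring
  simp only [reducedEnergy, angVel, vel, dotProduct, Fin.sum_univ_three, hI]
  simp
  field_simp
  ring

/-- On the level sets of the first integrals the momenta are bounded: `P` because `|P|²` is fixed,
and then `Π` because the potential energy is bounded and the energy is a positive definite
function of `Π`, up to a shift by multiples of `P`. -/
theorem momenta_bounded (hI₃ : 0 < V.I₃) (hM₁ : 0 < V.M₁) (hM₃ : 0 < V.M₃) (hΔ : 0 < V.Δ)
    (ε ρ : ℝ) : ∃ R, ∀ Γ Pa Pl : Vec, Γ 2 ^ 2 ≤ 1 → Pl ⬝ᵥ Pl = ρ →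
      V.reducedEnergy Γ Pa Pl = ε → ‖Pa‖ ≤ R ∧ ‖Pl‖ ≤ R := by
  set κ := V.m * V.l / V.M₁ with hκ
  set T := 2 * |ε| + 2 * |V.m * V.g * V.l| with hT
  have hT0 : 0 ≤ T := by positivity
  have key : ∀ x B : ℝ, x ^ 2 ≤ B → |x| ≤ 1 + B := fun x B h => by
    rw [abs_le]; constructor <;> nlinarith [sq_nonneg (x + 1), sq_nonneg (x - 1)]
  refine ⟨1 + (|ρ| + V.I₃ * T + 2 * (V.Δ / V.M₁ * T) + 2 * (κ ^ 2 * |ρ|)), ?_⟩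
  intro Γ Pa Pl hΓ hρ hε
  have hE := reducedEnergy_eq hΔ.ne' hM₁.ne' Γ Pa Pl
  rw [hε, ← hκ] at hE
  have hρ2 : Pl 0 ^ 2 + Pl 1 ^ 2 + Pl 2 ^ 2 = ρ := by
    rw [← hρ]; simp [dotProduct, Fin.sum_univ_three, sq]
  have hΓ1 : |Γ 2| ≤ 1 := (sq_le_one_iff_abs_le_one _).1 hΓ
  have hpot : V.m * V.g * V.l * Γ 2 ≤ |V.m * V.g * V.l| := by
    refine (le_abs_self _).trans ?_
    rw [abs_mul]
    exact mul_le_of_le_one_right (abs_nonneg _) hΓ1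
  have hT' : 2 * ε + 2 * (V.m * V.g * V.l) * Γ 2 ≤ T := by
    linarith [le_abs_self ε]
  have hρ' := le_abs_self ρ
  have n1 : 0 ≤ (Pl 0 ^ 2 + Pl 1 ^ 2) / V.M₁ := by positivity
  have n2 : 0 ≤ Pa 2 ^ 2 / V.I₃ := by positivity
  have n3 : 0 ≤ Pl 2 ^ 2 / V.M₃ := by positivity
  have n4 : 0 ≤ V.M₁ / V.Δ * ((Pa 0 + κ * Pl 1) ^ 2 + (Pa 1 - κ * Pl 0) ^ 2) := by positivity
  have b2 : Pa 2 ^ 2 ≤ V.I₃ * T := by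
    rw [mul_comm]; exact (div_le_iff₀ hI₃).1 (by linarith)
  have bs : (Pa 0 + κ * Pl 1) ^ 2 + (Pa 1 - κ * Pl 0) ^ 2 ≤ V.Δ / V.M₁ * T := by
    have h : V.M₁ / V.Δ * ((Pa 0 + κ * Pl 1) ^ 2 + (Pa 1 - κ * Pl 0) ^ 2) ≤ T := by linarith
    calc _ = V.Δ / V.M₁ * (V.M₁ / V.Δ * ((Pa 0 + κ * Pl 1) ^ 2 + (Pa 1 - κ * Pl 0) ^ 2)) := by
          field_simp
      _ ≤ _ := by gcongr
  have q0 := sq_nonneg (Pl 0)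
  have q1 := sq_nonneg (Pl 1)
  have q2 := sq_nonneg (Pl 2)
  have k1 : κ ^ 2 * Pl 1 ^ 2 ≤ κ ^ 2 * |ρ| := by gcongr; linarith
  have k0 : κ ^ 2 * Pl 0 ^ 2 ≤ κ ^ 2 * |ρ| := by gcongr; linarith
  have a0 : Pa 0 ^ 2 ≤ 2 * (V.Δ / V.M₁ * T) + 2 * (κ ^ 2 * |ρ|) := by
    have e : Pa 0 ^ 2 + (Pa 0 + 2 * κ * Pl 1) ^ 2
        = 2 * (Pa 0 + κ * Pl 1) ^ 2 + 2 * (κ ^ 2 * Pl 1 ^ 2) := by ring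
    linarith [sq_nonneg (Pa 0 + 2 * κ * Pl 1), sq_nonneg (Pa 1 - κ * Pl 0)]
  have a1 : Pa 1 ^ 2 ≤ 2 * (V.Δ / V.M₁ * T) + 2 * (κ ^ 2 * |ρ|) := by
    have e : Pa 1 ^ 2 + (Pa 1 - 2 * κ * Pl 0) ^ 2
        = 2 * (Pa 1 - κ * Pl 0) ^ 2 + 2 * (κ ^ 2 * Pl 0 ^ 2) := by ring
    linarith [sq_nonneg (Pa 1 - 2 * κ * Pl 0), sq_nonneg (Pa 0 + κ * Pl 1)]
  have p1 : 0 ≤ |ρ| := abs_nonneg ρ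
  have p2 : 0 ≤ V.I₃ * T := by positivity
  have p3 : 0 ≤ V.Δ / V.M₁ * T := by positivity
  have p4 : 0 ≤ κ ^ 2 * |ρ| := by positivity
  have hnn : 0 ≤ 1 + (|ρ| + V.I₃ * T + 2 * (V.Δ / V.M₁ * T) + 2 * (κ ^ 2 * |ρ|)) := by linarith
  constructor
  · rw [pi_norm_le_iff_of_nonneg hnn]
    intro i
    rw [Real.norm_eq_abs]
    apply key
    fin_cases i <;> simp only [Fin.zero_eta, Fin.mk_one, Fin.reduceFinMk] <;> linarith
  · rw [pi_norm_le_iff_of_nonneg hnn]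
    intro i
    rw [Real.norm_eq_abs]
    apply key
    fin_cases i <;> simp only [Fin.zero_eta, Fin.mk_one, Fin.reduceFinMk] <;> linarith

variable (V)

/-- The vector field of the equations of motion of the rows of `A` and of the body momenta. The
position `b` is left out, since it does not enter the equations of the other variables. -/
def rowField (y : (Fin 3 → Vec) × Vec × Vec) : (Fin 3 → Vec) × Vec × Vec :=
  (fun i => y.1 i ⨯₃ V.angVel y.2.1 y.2.2,
    y.2.1 ⨯₃ V.angVel y.2.1 y.2.2 + y.2.2 ⨯₃ V.vel y.2.1 y.2.2
      - (V.m * V.g * V.l) • (y.1 2 ⨯₃ e₃),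
    y.2.2 ⨯₃ V.angVel y.2.1 y.2.2)

theorem contDiff_cross {X : Type*} [NormedAddCommGroup X] [NormedSpace ℝ X] {n : WithTop ℕ∞}
    {u w : X → Vec} (hu : ContDiff ℝ n u) (hw : ContDiff ℝ n w) :
    ContDiff ℝ n fun x => u x ⨯₃ w x := by
  rw [contDiff_pi] at hu hw ⊢
  have h0 := hu 0
  have h1 := hu 1
  have h2 := hu 2
  have k0 := hw 0
  have k1 := hw 1
  have k2 := hw 2
  intro i
  fin_cases i <;> simp [cross_apply] <;> fun_prop

theorem contDiff_velocities {n : WithTop ℕ∞} :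
    ContDiff ℝ n (fun z : Vec × Vec => V.angVel z.1 z.2) ∧
      ContDiff ℝ n (fun z : Vec × Vec => V.vel z.1 z.2) := by
  constructor <;> rw [contDiff_pi] <;> intro i <;> fin_cases i <;> simp [angVel, vel] <;> fun_prop

theorem contDiff_rowField {n : WithTop ℕ∞} : ContDiff ℝ n V.rowField := by
  obtain ⟨h1, h2⟩ := V.contDiff_velocities (n := n)
  have hΩ : ContDiff ℝ n fun y : (Fin 3 → Vec) × Vec × Vec => V.angVel y.2.1 y.2.2 :=
    h1.comp contDiff_snd
  have hv : ContDiff ℝ n fun y : (Fin 3 → Vec) × Vec × Vec => V.vel y.2.1 y.2.2 :=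
    h2.comp contDiff_snd
  have hr : ∀ i, ContDiff ℝ n fun y : (Fin 3 → Vec) × Vec × Vec => y.1 i := fun i => by fun_prop
  refine ContDiff.prodMk (contDiff_pi.2 fun i => contDiff_cross (hr i) hΩ)
    (ContDiff.prodMk ?_ (contDiff_cross (by fun_prop) hΩ))
  exact ((contDiff_cross (by fun_prop) hΩ).add (contDiff_cross (by fun_prop) hv)).sub
    ((contDiff_cross (hr 2) contDiff_const).const_smul _)

variable {V}

theorem rescaledMotion_of_rowField {c : ℝ → ℝ} {y : ℝ → (Fin 3 → Vec) × Vec × Vec}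
    (hy : ∀ t, HasDerivAt y (c t • V.rowField (y t)) t) :
    (∀ i t, HasDerivAt (fun s => (y s).1 i)
      (c t • ((y t).1 i ⨯₃ V.angVel (y t).2.1 (y t).2.2)) t) ∧
    V.IsRescaledMotion c (fun s => (y s).1 2) (fun s => (y s).2.1) (fun s => (y s).2.2) := by
  have hr : ∀ i t, HasDerivAt (fun s => (y s).1 i)
      (c t • ((y t).1 i ⨯₃ V.angVel (y t).2.1 (y t).2.2)) t := fun i t =>
    hasDerivAt_pi.1 (hy t).fst i
  exact ⟨hr, hr 2, fun t => (hy t).snd.fst, fun t => (hy t).snd.snd⟩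

theorem det_eq_triple (A : Matrix (Fin 3) (Fin 3) ℝ) : A.det = A 0 ⬝ᵥ (A 1 ⨯₃ A 2) := by
  simp [Matrix.det_fin_three, dotProduct, Fin.sum_univ_three, cross_apply]; ring

theorem row_dotProduct_row (A : Matrix.specialOrthogonalGroup (Fin 3) ℝ) (i j : Fin 3) :
    (A : Matrix (Fin 3) (Fin 3) ℝ) i ⬝ᵥ (A : Matrix (Fin 3) (Fin 3) ℝ) j
      = (1 : Matrix (Fin 3) (Fin 3) ℝ) i j := by
  have h := (Matrix.mem_orthogonalGroup_iff (Fin 3) ℝ).1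
    ((Matrix.mem_specialOrthogonalGroup_iff).1 A.2).1
  exact congrFun (congrFun h i) j

theorem abs_le_one_of_row_unit {u : Vec} (h : u ⬝ᵥ u = 1) (j : Fin 3) : |u j| ≤ 1 := by
  rw [← sq_le_one_iff_abs_le_one]
  simp only [dotProduct, Fin.sum_univ_three] at h
  fin_cases j <;> simp only [Fin.zero_eta, Fin.mk_one, Fin.reduceFinMk] <;>
    nlinarith [sq_nonneg (u 0), sq_nonneg (u 1), sq_nonneg (u 2)]

/-- Every initial condition has a motion for all times: `A` stays in `SO(3)`, and the momenta are
bounded by the first integrals, so that the equations of `A, Π, P` have a global solution; the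
position is then found by integration. -/
theorem exists_isMotion (hI₃ : 0 < V.I₃) (hM₁ : 0 < V.M₁) (hM₃ : 0 < V.M₃) (hΔ : 0 < V.Δ)
    (x : Phase) : ∃ γ : ℝ → Phase, V.IsMotion γ ∧ γ 0 = x := by
  let y₀ : (Fin 3 → Vec) × Vec × Vec := (fun i => (x.A : Matrix (Fin 3) (Fin 3) ℝ) i, x.ang, x.lin)
  have hrow : ∀ (c : ℝ → ℝ) (y : ℝ → (Fin 3 → Vec) × Vec × Vec), y 0 = y₀ →
      (∀ t, HasDerivAt y (c t • V.rowField (y t)) t) → ∀ t i j,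
      (y t).1 i ⬝ᵥ (y t).1 j = (1 : Matrix (Fin 3) (Fin 3) ℝ) i j := by
    intro c y h0 hy t i j
    obtain ⟨hr, -⟩ := rescaledMotion_of_rowField hy
    have h := dotProduct_conserved (hr i) (hr j) t
    rw [h, h0]
    exact row_dotProduct_row x.A i j
  obtain ⟨R, hR⟩ := momenta_bounded hI₃ hM₁ hM₃ hΔ
    (V.reducedEnergy (y₀.1 2) x.ang x.lin) (x.lin ⬝ᵥ x.lin)
  obtain ⟨y, h0, hy⟩ := exists_isIntegralCurve_of_bounded_rescalings (V.contDiff_rowField) y₀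
    (max 1 R) (by
      intro c y h0 hy t
      obtain ⟨hr, hm⟩ := rescaledMotion_of_rowField hy
      have hu : ∀ i, (y t).1 i ⬝ᵥ (y t).1 i = 1 := fun i => by
        rw [hrow c y h0 hy t i i, Matrix.one_apply_eq]
      have hb := hR ((y t).1 2) (y t).2.1 (y t).2.2
        ((sq_le_one_iff_abs_le_one _).2 (abs_le_one_of_row_unit (hu 2) 2))
        (by rw [dotProduct_conserved hm.lin hm.lin t, h0])
        (by rw [hm.energy t, h0])
      refine max_le ?_ (max_le (hb.1.trans (le_max_right _ _)) (hb.2.trans (le_max_right _ _)))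
      rw [pi_norm_le_iff_of_nonneg (by positivity)]
      intro i
      rw [pi_norm_le_iff_of_nonneg (by positivity)]
      intro j
      exact (abs_le_one_of_row_unit (hu i) j).trans (le_max_left _ _))
  have hy' : ∀ t, HasDerivAt y ((fun _ => (1 : ℝ)) t • V.rowField (y t)) t := fun t => by
    simpa using hy t
  obtain ⟨hr, hm⟩ := rescaledMotion_of_rowField hy'
  have hmem : ∀ t, (Matrix.of (y t).1 : Matrix (Fin 3) (Fin 3) ℝ) ∈
      Matrix.specialOrthogonalGroup (Fin 3) ℝ := by
    intro t
    rw [Matrix.mem_specialOrthogonalGroup_iff, Matrix.mem_orthogonalGroup_iff]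
    refine ⟨?_, ?_⟩
    · ext i j
      exact hrow _ y h0 hy' t i j
    · rw [det_eq_triple]
      have h := tripleProduct_conserved (hr 0) (hr 1) (hr 2) t
      refine h.trans ?_
      rw [h0]
      exact (det_eq_triple x.A).symm.trans (Matrix.mem_specialOrthogonalGroup_iff.1 x.A.2).2
  have hcont : Continuous y := continuous_iff_continuousAt.2 fun t => (hy t).continuousAt
  have hvel : Continuous fun t => (Matrix.of (y t).1 : Matrix (Fin 3) (Fin 3) ℝ) *ᵥ
      V.vel (y t).2.1 (y t).2.2 := by
    have h1 : Continuous fun t => V.vel (y t).2.1 (y t).2.2 :=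
      (V.contDiff_velocities (n := 0)).2.continuous.comp hcont.snd
    have h2 : Continuous fun t => (Matrix.of (y t).1 : Matrix (Fin 3) (Fin 3) ℝ) := hcont.fst
    exact h2.matrix_mulVec h1
  refine ⟨fun t => ⟨⟨Matrix.of (y t).1, hmem t⟩,
    x.b + ∫ s in (0 : ℝ)..t, (Matrix.of (y s).1 : Matrix (Fin 3) (Fin 3) ℝ) *ᵥ
      V.vel (y s).2.1 (y s).2.2, (y t).2.1, (y t).2.2⟩, fun t => ⟨fun i j => ?_, ?_, ?_, ?_⟩, ?_⟩
  · refine (hasDerivAt_pi.1 (hr i t) j).congr_deriv ?_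
    fin_cases j <;> simp [cross_apply, hat, Matrix.mul_apply, Fin.sum_univ_three] <;> ring
  · exact (intervalIntegral.integral_hasDerivAt_right (hvel.intervalIntegrable _ _)
      hvel.stronglyMeasurable.stronglyMeasurableAtFilter hvel.continuousAt).const_add _
  · refine (hm.ang t).congr_deriv ?_
    have hΓ : (Matrix.of (y t).1 : Matrix (Fin 3) (Fin 3) ℝ)ᵀ *ᵥ e₃ = (y t).1 2 := by
      ext i; simp [Matrix.mulVec, dotProduct, Fin.sum_univ_three, e₃]
    rw [one_smul, hΓ]
  · simpa using hm.lin t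
  · ext1
    · apply Subtype.ext
      simp only [h0]
      rfl
    · simp
    · simp [h0, y₀]
    · simp [h0, y₀]

end Vehicle

/-! ### Stability by energy-momentum confinement -/

/-- The first integrals of the system for `Γ, Π, P`: the geometric ones `|Γ|², P · Γ, |P|²`, the
spin momentum (up to sign), and the energy. -/
def Vehicle.integrals (V : Vehicle) (z : Vec × Vec × Vec) : ℝ × ℝ × ℝ × ℝ × ℝ :=
  (z.1 ⬝ᵥ z.1, z.2.2 ⬝ᵥ z.1, z.2.2 ⬝ᵥ z.2.2, z.2.1 2, V.reducedEnergy z.1 z.2.1 z.2.2)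

/-- The values of `Γ, Π, P` at a phase point. They determine it up to the rotations of space about
the vertical axis and the translations. -/
def Phase.body (x : Phase) : Vec × Vec × Vec :=
  ((x.A : Matrix (Fin 3) (Fin 3) ℝ) 2, x.ang, x.lin)

theorem one_row_two : (1 : Matrix (Fin 3) (Fin 3) ℝ) 2 = e₃ := by
  ext i
  fin_cases i
  · simp [e₃]
  · simp [e₃]
  · exact Matrix.one_apply_eq 2

theorem body_relEq (P S : ℝ) : (relEq P S).body = (e₃, S • e₃, P • e₃) := by
  have h : ((relEq P S).A : Matrix (Fin 3) (Fin 3) ℝ) 2 = e₃ := by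
    exact one_row_two
  simp only [Phase.body, h]
  rfl

theorem transpose_mulVec_e₃ (A : Matrix (Fin 3) (Fin 3) ℝ) : Aᵀ *ᵥ e₃ = A 2 := by
  ext i; simp [Matrix.mulVec, dotProduct, Fin.sum_univ_three, e₃]

theorem isInducing_phase : Topology.IsInducing
    fun x : Phase => ((x.A : Matrix (Fin 3) (Fin 3) ℝ), x.b, x.ang, x.lin) := by
  have h1 : Topology.IsInducing fun x : Phase => (x.A, x.b, x.ang, x.lin) := ⟨rfl⟩
  exact (Topology.IsInducing.subtypeVal.prodMap Topology.IsInducing.id).comp h1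

theorem continuous_body : Continuous Phase.body := by
  have h := isInducing_phase.continuous
  have hA : Continuous fun x : Phase => (x.A : Matrix (Fin 3) (Fin 3) ℝ) := h.fst
  exact ((continuous_apply 2).comp hA).prodMk h.snd.snd

/-- A rotation that fixes the vertical axis is a rotation about the vertical axis. -/
theorem exists_rot_eq (R : Matrix.specialOrthogonalGroup (Fin 3) ℝ)
    (hR : (R : Matrix (Fin 3) (Fin 3) ℝ) 2 = e₃) : ∃ φ : Real.Angle, R = rot φ := by
  have hrow := Vehicle.row_dotProduct_row R
  have hdet := (Matrix.mem_specialOrthogonalGroup_iff.1 R.2).2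
  obtain ⟨M, hM⟩ := R
  change M 2 = e₃ at hR
  change M.det = 1 at hdet
  change ∀ i j, M i ⬝ᵥ M j = _ at hrow
  have e0 : M 2 0 = 0 := by rw [hR]; simp [e₃]
  have e1 : M 2 1 = 0 := by rw [hR]; simp [e₃]
  have e2 : M 2 2 = 1 := by rw [hR]; simp [e₃]
  have h02 := hrow 0 2
  have h12 := hrow 1 2
  have h00 := hrow 0 0
  have h11 := hrow 1 1
  have h01 := hrow 0 1
  simp [dotProduct, Fin.sum_univ_three, e0, e1, e2] at h02 h12 h00 h11 h01
  rw [Matrix.det_fin_three] at hdet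
  simp only [e0, e1, e2, h02, h12] at hdet h00 h11 h01
  -- the upper left block has orthonormal rows and determinant `1`, so it is a plane rotation
  have hs : (M 0 0 - M 1 1) ^ 2 + (M 0 1 + M 1 0) ^ 2 = 0 := by
    linear_combination h00 + h11 - 2 * hdet
  have hc1 : M 0 0 = M 1 1 := by nlinarith [sq_nonneg (M 0 0 - M 1 1), sq_nonneg (M 0 1 + M 1 0)]
  have hc2 : M 0 1 = -M 1 0 := by nlinarith [sq_nonneg (M 0 0 - M 1 1), sq_nonneg (M 0 1 + M 1 0)]
  have hn : ‖(⟨M 0 0, M 1 0⟩ : ℂ)‖ = 1 := by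
    rw [Complex.norm_def, Complex.normSq_mk, Real.sqrt_eq_one]
    rw [hc2] at h00
    linarith
  have hne : (⟨M 0 0, M 1 0⟩ : ℂ) ≠ 0 := fun h => by simp [h] at hn
  refine ⟨(Complex.arg ⟨M 0 0, M 1 0⟩ : ℝ), Subtype.ext ?_⟩
  have hcos : Real.cos (Complex.arg ⟨M 0 0, M 1 0⟩) = M 0 0 := by
    rw [Complex.cos_arg hne, hn, div_one]
  have hsin : Real.sin (Complex.arg ⟨M 0 0, M 1 0⟩) = M 1 0 := by
    rw [Complex.sin_arg, hn, div_one]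
  change M = rotMat _
  ext i j
  fin_cases i <;> fin_cases j <;>
    simp [rotMat, hcos, hsin, e0, e1, e2, h02, h12, hc2, ← hc1]

theorem sliceA_zero : sliceA 0 = 1 := (slice_relEq ⟨0, 0, 0, 0, 0, 0, 0⟩ 0 0).1

/-- An invariant neighbourhood of the relative equilibrium contains all phase points whose
`Γ, Π, P` are close to those of the relative equilibrium: up to symmetries, such a point has the
attitude `sliceA` and the position `0`. -/
theorem invariant_mem_of_body_near {P S : ℝ} {U : Set Phase} (hU : IsOpen U)
    (hinv : ∀ g : Sym, ∀ y ∈ U, g • y ∈ U) (hx : relEq P S ∈ U) :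
    ∀ᶠ z in 𝓝 (e₃, S • e₃, P • e₃), ∀ x : Phase, x.body = z → x ∈ U := by
  obtain ⟨O, hO, hOU⟩ := isInducing_phase.isOpen_iff.1 hU
  let w : Vec × Vec × Vec → Red := fun z => ![z.1 0, z.1 1, 0, 0]
  have hw0 : w (e₃, S • e₃, P • e₃) = 0 := by
    ext i; fin_cases i <;> simp [w, e₃]
  have hwc : Continuous w := by
    refine continuous_pi fun i => ?_
    fin_cases i <;> simp [w] <;> fun_prop
  have hF : Continuous sliceF := by
    unfold sliceF sliceΓ
    refine continuous_const.div (by fun_prop) fun w => ?_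
    have := Real.sqrt_nonneg (1 - w 0 ^ 2 - w 1 ^ 2)
    positivity
  have hA : Continuous sliceA := by
    refine continuous_matrix fun i j => ?_
    simp only [sliceA_entries]
    fin_cases i <;> fin_cases j <;> simp <;> fun_prop
  have hψ : Continuous fun z : Vec × Vec × Vec => (sliceA (w z), (0 : Vec), z.2.1, z.2.2) := by
    fun_prop
  have h1 : ∀ᶠ z in 𝓝 (e₃, S • e₃, P • e₃), (sliceA (w z), (0 : Vec), z.2.1, z.2.2) ∈ O := by
    refine hψ.continuousAt.eventually_mem (hO.mem_nhds ?_)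
    rw [← hOU] at hx
    simp only [hw0, sliceA_zero]
    exact hx
  have h2 : ∀ᶠ z : Vec × Vec × Vec in 𝓝 (e₃, S • e₃, P • e₃), 0 < z.1 2 := by
    have hc : Continuous fun z : Vec × Vec × Vec => z.1 2 := by fun_prop
    exact hc.continuousAt.eventually_const_lt (by simp [e₃])
  filter_upwards [h1, h2] with z hz hpos x hxz
  have hΓ : (x.A : Matrix (Fin 3) (Fin 3) ℝ) 2 = z.1 := congrArg Prod.fst hxz
  have hunit : z.1 0 ^ 2 + z.1 1 ^ 2 + z.1 2 ^ 2 = 1 := by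
    have h := Vehicle.row_dotProduct_row x.A 2 2
    rw [hΓ, Matrix.one_apply_eq] at h
    rw [← h]; simp [dotProduct, Fin.sum_univ_three, sq]
  have hw : w z 0 ^ 2 + w z 1 ^ 2 ≤ 1 := by
    simp [w]; nlinarith [sq_nonneg (z.1 2)]
  -- `B` has the same third row `Γ` as `A`, so `A B⁻¹` is a rotation about the vertical axis
  let B : Matrix.specialOrthogonalGroup (Fin 3) ℝ := ⟨sliceA (w z), sliceA_mem (w z) hw⟩
  have hB2 : (B : Matrix (Fin 3) (Fin 3) ℝ) 2 = z.1 := by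
    change sliceA (w z) 2 = z.1
    have hΓ3 : sliceΓ (w z) = z.1 2 := by
      rw [sliceΓ, ← Real.sqrt_sq hpos.le]
      congr 1
      simp [w]; linarith
    rw [sliceA_eq _ hw]
    ext i
    fin_cases i <;> simp [w, hΓ3]
  obtain ⟨φ, hφ⟩ := exists_rot_eq (x.A * B⁻¹) (by
    have h : (x.A : Matrix (Fin 3) (Fin 3) ℝ) * ((B⁻¹ :) : Matrix (Fin 3) (Fin 3) ℝ)
        = ((x.A * B⁻¹ :) : Matrix (Fin 3) (Fin 3) ℝ) := rfl
    have h' : (B : Matrix (Fin 3) (Fin 3) ℝ) * ((B⁻¹ :) : Matrix (Fin 3) (Fin 3) ℝ) = 1 :=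
      congrArg Subtype.val (mul_inv_cancel B)
    have hr : ((x.A * B⁻¹ :) : Matrix (Fin 3) (Fin 3) ℝ) 2 = (1 : Matrix (Fin 3) (Fin 3) ℝ) 2 := by
      rw [← h, ← h', Matrix.mul_apply_eq_vecMul, Matrix.mul_apply_eq_vecMul, hΓ, hB2]
    rw [hr, one_row_two])
  have hAB : x.A = rot φ * B := by rw [← hφ, inv_mul_cancel_right]
  let g : Sym := ⟨-φ, -(rotMat (-φ) *ᵥ x.b), 0⟩
  have hg : g • x ∈ U := by
    rw [← hOU]
    have hgA : (g • x).A = B := by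
      change rot (-φ) * x.A * rot (-0) = B
      rw [hAB, neg_zero, rot_zero, mul_one, ← mul_assoc, ← rot_add, neg_add_cancel, rot_zero,
        one_mul]
    have hgb : (g • x).b = 0 := add_neg_cancel _
    have hgang : (g • x).ang = z.2.1 := by
      change rotMat 0 *ᵥ x.ang = _
      rw [rotMat_zero, Matrix.one_mulVec, ← hxz]; rfl
    have hglin : (g • x).lin = z.2.2 := by
      change rotMat 0 *ᵥ x.lin = _
      rw [rotMat_zero, Matrix.one_mulVec, ← hxz]; rfl
    rw [Set.mem_preimage, hgA, hgb, hgang, hglin]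
    exact hz
  have := hinv g⁻¹ _ hg
  rwa [inv_smul_smul] at this

theorem sq_add_sq_add_sq_eq_zero {a b c : ℝ} (h : a ^ 2 + b ^ 2 + c ^ 2 = 0) :
    a = 0 ∧ b = 0 ∧ c = 0 := by
  have ha := sq_nonneg a
  have hb := sq_nonneg b
  have hc := sq_nonneg c
  refine ⟨pow_eq_zero_iff two_ne_zero |>.1 ?_, pow_eq_zero_iff two_ne_zero |>.1 ?_,
    pow_eq_zero_iff two_ne_zero |>.1 ?_⟩ <;> linarith

namespace Vehicle

variable {V : Vehicle}

theorem continuous_integrals : Continuous V.integrals := by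
  have hΩ : Continuous fun z : Vec × Vec × Vec => V.angVel z.2.1 z.2.2 :=
    (V.contDiff_velocities (n := 0)).1.continuous.comp continuous_snd
  have hv : Continuous fun z : Vec × Vec × Vec => V.vel z.2.1 z.2.2 :=
    (V.contDiff_velocities (n := 0)).2.continuous.comp continuous_snd
  unfold integrals reducedEnergy
  fun_prop

/-- The relative equilibrium is isolated in its level set. The geometric integrals force `P = P_e Γ`
there, and with `ζ = 1 - Γ₃ ≥ 0`, `c = (1 / M₁ - 1 / M₃) P_e²` the energy balance reads
`(M₁ / Δ) |…|² + ζ (2 (mgl + c) - c ζ) = 0`, where both summands are nonnegative for small `ζ`. -/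
theorem isolated_relEq (hM₁ : 0 < V.M₁) (hΔ : 0 < V.Δ) {P S : ℝ}
    (hK : V.m * V.g * V.l > (1 / V.M₃ - 1 / V.M₁) * P ^ 2) :
    ∀ᶠ z in 𝓝 (e₃, S • e₃, P • e₃),
      V.integrals z = V.integrals (e₃, S • e₃, P • e₃) → z = (e₃, S • e₃, P • e₃) := by
  set c := (1 / V.M₁ - 1 / V.M₃) * P ^ 2 with hc
  set μ := V.m * V.g * V.l with hμ
  have hK' : 0 < μ + c := by rw [hc]; linarith
  have hnear : ∀ᶠ z : Vec × Vec × Vec in 𝓝 (e₃, S • e₃, P • e₃),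
      0 < 2 * (μ + c) - c * (1 - z.1 2) := by
    have hcont : Continuous fun z : Vec × Vec × Vec => 2 * (μ + c) - c * (1 - z.1 2) := by fun_prop
    exact hcont.continuousAt.eventually_const_lt (by simpa [e₃] using hK')
  filter_upwards [hnear]
  rintro ⟨Γ, Pa, Pl⟩ hz heq
  simp only [integrals, Prod.mk.injEq] at heq hz
  obtain ⟨hΓ, hPΓ, hP, hS, hE⟩ := heq
  have hE2 := congrArg (2 * ·) hE
  simp only [reducedEnergy_eq hΔ.ne' hM₁.ne'] at hE2
  simp [dotProduct, Fin.sum_univ_three, e₃] at hΓ hPΓ hP hS hE2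
  rw [← hμ, hS] at hE2
  have hPe : (Pl 0 - P * Γ 0) ^ 2 + (Pl 1 - P * Γ 1) ^ 2 + (Pl 2 - P * Γ 2) ^ 2 = 0 := by
    linear_combination hP - 2 * P * hPΓ + P ^ 2 * hΓ
  obtain ⟨hl0, hl1, hl2⟩ := sq_add_sq_add_sq_eq_zero hPe
  rw [sub_eq_zero] at hl0 hl1 hl2
  rw [hl0, hl1, hl2] at hE2
  have ha : 0 < V.M₁ / V.Δ := by positivity
  set X := Pa 0 + V.m * V.l / V.M₁ * (P * Γ 1) with hX
  set Y := Pa 1 - V.m * V.l / V.M₁ * (P * Γ 0) with hY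
  have hbal : V.M₁ / V.Δ * (X ^ 2 + Y ^ 2)
      + (1 - Γ 2) * (2 * (μ + c) - c * (1 - Γ 2)) = 0 := by
    rw [hc]
    linear_combination hE2 - P ^ 2 / V.M₁ * hΓ
  have hζ : 0 ≤ 1 - Γ 2 := by nlinarith [sq_nonneg (Γ 0), sq_nonneg (Γ 1)]
  have n1 : 0 ≤ V.M₁ / V.Δ * (X ^ 2 + Y ^ 2) := by positivity
  have n2 : 0 ≤ (1 - Γ 2) * (2 * (μ + c) - c * (1 - Γ 2)) := mul_nonneg hζ hz.le
  have hΓ2 : Γ 2 = 1 := by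
    have h : (1 - Γ 2) * (2 * (μ + c) - c * (1 - Γ 2)) = 0 := by linarith
    have := (mul_eq_zero.1 h).resolve_right hz.ne'
    linarith
  have hXY : X ^ 2 + Y ^ 2 = 0 := by
    have h : V.M₁ / V.Δ * (X ^ 2 + Y ^ 2) = 0 := by linarith
    exact (mul_eq_zero.1 h).resolve_left ha.ne'
  obtain ⟨hX0, hY0, -⟩ := sq_add_sq_add_sq_eq_zero (c := 0)
    (by linarith : X ^ 2 + Y ^ 2 + 0 ^ 2 = 0)
  obtain ⟨hΓ0, hΓ1, -⟩ := sq_add_sq_add_sq_eq_zero (c := 0)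
    (by rw [hΓ2] at hΓ; linarith : Γ 0 ^ 2 + Γ 1 ^ 2 + 0 ^ 2 = 0)
  simp only [hΓ0, hΓ1, mul_zero, add_zero, sub_zero] at hX hY
  rw [hX0] at hX
  rw [hY0] at hY
  refine Prod.ext ?_ (Prod.ext ?_ ?_) <;> ext i <;> fin_cases i <;>
    simp [e₃, hΓ0, hΓ1, hΓ2, hS, ← hX, ← hY, hl0, hl1, hl2]

theorem IsMotion.isRescaledMotion {γ : ℝ → Phase} (h : V.IsMotion γ) :
    V.IsRescaledMotion 1 (fun s => (γ s).body.1) (fun s => (γ s).body.2.1)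
      (fun s => (γ s).body.2.2) := by
  refine ⟨fun t => ?_, fun t => ?_, fun t => ?_⟩
  · rw [hasDerivAt_pi]
    intro j
    refine ((h t).1 2 j).congr_deriv ?_
    fin_cases j <;>
      simp [Phase.body, cross_apply, hat, Matrix.mul_apply, Fin.sum_univ_three] <;> ring
  · have h1 := (h t).2.2.1
    rw [transpose_mulVec_e₃] at h1
    simpa [Phase.body] using h1
  · simpa [Phase.body] using (h t).2.2.2

theorem IsRescaledMotion.integrals {c : ℝ → ℝ} {Γ Pa Pl : ℝ → Vec}
    (h : V.IsRescaledMotion c Γ Pa Pl) (t : ℝ) :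
    V.integrals (Γ t, Pa t, Pl t) = V.integrals (Γ 0, Pa 0, Pl 0) := by
  simp only [Vehicle.integrals, dotProduct_conserved h.vert h.vert t,
    dotProduct_conserved h.lin h.vert t, dotProduct_conserved h.lin h.lin t, h.spin t, h.energy t]

/-- A motion stays in the invariant neighbourhood since its `Γ, Π, P` conserve the first integrals,
in whose level set those of the relative equilibrium are isolated. -/
theorem isSymStable_relEq (hI₃ : 0 < V.I₃) (hM₁ : 0 < V.M₁) (hM₃ : 0 < V.M₃) (hΔ : 0 < V.Δ)
    {P S : ℝ} (hK : V.m * V.g * V.l > (1 / V.M₃ - 1 / V.M₁) * P ^ 2) :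
    V.IsSymStable (relEq P S) := by
  intro U hU hinv hx
  obtain ⟨N, hN, hconf⟩ := confined_of_isolated_level (V.continuous_integrals)
    ((isolated_relEq hM₁ hΔ hK).mono fun z hz h => by rw [hz h, dist_self])
    (invariant_mem_of_body_near hU hinv hx)
  rw [← body_relEq] at hN
  refine ⟨Phase.body ⁻¹' N, continuous_body.continuousAt.preimage_mem_nhds hN, fun y hy => ?_⟩
  refine ⟨exists_isMotion hI₃ hM₁ hM₃ hΔ y, fun γ hγ h0 t => ?_⟩
  have hm := hγ.isRescaledMotion
  have hcont : Continuous fun s => (γ s).body := by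
    have c1 := continuous_iff_continuousAt.2 fun s => (hm.vert s).continuousAt
    have c2 := continuous_iff_continuousAt.2 fun s => (hm.ang s).continuousAt
    have c3 := continuous_iff_continuousAt.2 fun s => (hm.lin s).continuousAt
    exact c1.prodMk (c2.prodMk c3)
  exact hconf (fun s => (γ s).body) hcont (by simpa [h0] using hy) hm.integrals t (γ t) rfl

end Vehicle

/-! ### The Hessian of the reduced Hamiltonian -/

theorem fderiv_single_of_hasDerivAt_update {h : Red → ℝ} {w : Red} {k : Fin 4} {d : ℝ}
    (hh : DifferentiableAt ℝ h w)
    (hd : HasDerivAt (fun s => h (Function.update w k s)) d (w k)) :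
    fderiv ℝ h w (Pi.single k 1) = d := by
  have hu := hasDerivAt_update (𝕜 := ℝ) w k (w k)
  have hf : HasFDerivAt h (fderiv ℝ h w) (Function.update w k (w k)) := by
    rw [Function.update_eq_self]; exact hh.hasFDerivAt
  exact (hf.comp_hasDerivAt _ hu).unique hd

/-- If the gradient of `h` near `0` is `M(w) w` with `M` continuous at `0`, then `0` is a critical
point of `h` at which the Hessian is the transpose of `M(0)`. -/
theorem hessian_of_gradient {h : Red → ℝ} {M : Red → Matrix (Fin 4) (Fin 4) ℝ}
    (hM : ∀ k j, ContinuousAt (fun w => M w k j) 0)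
    (hg : ∀ᶠ w in 𝓝 0, ∀ k, fderiv ℝ h w (Pi.single k 1) = (M w *ᵥ w) k) :
    fderiv ℝ h 0 = 0 ∧ hessian h = (M 0)ᵀ := by
  constructor
  · refine ContinuousLinearMap.coe_injective (LinearMap.pi_ext' fun k => LinearMap.ext_ring ?_)
    simpa using hg.self_of_nhds k
  · ext i k
    have h1 : (fun w => fderiv ℝ h w (Pi.single k 1)) =ᶠ[𝓝 0] fun w => (M w *ᵥ w) k :=
      hg.mono fun w hw => hw k
    -- `M(w) w - M(0) w = o(w)` by the continuity of `M`
    have h2 : HasFDerivAt (fun w => (M w *ᵥ w) k)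
        (∑ j, M 0 k j • (ContinuousLinearMap.proj j : Red →L[ℝ] ℝ)) 0 := by
      have h3 : ∀ j, HasFDerivAt (fun w : Red => M w k j * w j)
          (M 0 k j • (ContinuousLinearMap.proj j : Red →L[ℝ] ℝ)) 0 := by
        intro j
        have hlin := ((ContinuousLinearMap.proj j : Red →L[ℝ] ℝ).isBigO_id (𝓝 0)).norm_right
        have ho : (fun w => M w k j - M 0 k j) =o[𝓝 0] fun _ : Red => (1 : ℝ) := by
          rw [Asymptotics.isLittleO_one_iff]
          simpa using (hM k j).tendsto.sub_const (M 0 k j)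
        rw [hasFDerivAt_iff_isLittleO_nhds_zero]
        have := ho.mul_isBigO hlin
        refine (this.congr_left fun w => ?_).trans_isBigO ?_
        · simp; ring
        · simpa using (Asymptotics.isBigO_refl (fun w : Red => w) (𝓝 0)).norm_left
      have h4 := HasFDerivAt.fun_sum (u := Finset.univ) fun j _ => h3 j
      exact h4
    simp only [hessian, Matrix.of_apply, Matrix.transpose_apply]
    rw [(h2.congr_of_eventuallyEq h1).fderiv]
    simp [Pi.single_apply]

namespace Vehicle

variable (V : Vehicle)

/-- The reduced Hamiltonian at the momentum of the relative equilibrium, as a function of the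
coordinates `x₀, x₁` (positions) and `x₂, x₃` (momenta) and of `c = √(1 - x₀² - x₁²)` and
`f = 1 / (1 + c)`. -/
def redHeFun (P S x₀ x₁ x₂ x₃ c f : ℝ) : ℝ :=
  1 / 2 * (V.M₁ / V.Δ * (x₂ ^ 2 + x₃ ^ 2 + 2 * S * (f * (x₃ * x₀ - x₂ * x₁)) + S ^ 2 * (2 * f - 1)
      - (x₂ * x₀ + x₃ * x₁) ^ 2)
    + 2 * (V.m * V.l / V.Δ * P) * ((x₂ * x₀ + x₃ * x₁) * c)
    + V.I₁ / V.Δ * P ^ 2 * (x₀ ^ 2 + x₁ ^ 2) + S ^ 2 / V.I₃ + P ^ 2 / V.M₃ * c ^ 2)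
    - V.m * V.g * V.l * c

/-- With `ρ = q₁² + q₂²`, these are `c = 1 - f ρ` and `f² ρ = 2 f - 1`, which follow from
`f (1 + c) = 1` and `c² = 1 - ρ`. -/
theorem slice_relations (w : Red) (hw : w 0 ^ 2 + w 1 ^ 2 ≤ 1) :
    sliceΓ w = 1 - sliceF w * (w 0 ^ 2 + w 1 ^ 2) ∧
      sliceF w ^ 2 * (w 0 ^ 2 + w 1 ^ 2) = 2 * sliceF w - 1 := by
  have h0 : 0 ≤ sliceΓ w := Real.sqrt_nonneg _
  have h1 : sliceΓ w ^ 2 = 1 - w 0 ^ 2 - w 1 ^ 2 := Real.sq_sqrt (by linarith)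
  have h3 : sliceF w * (1 + sliceΓ w) = 1 := by
    have : 1 + sliceΓ w ≠ 0 := by positivity
    rw [sliceF]; field_simp
  have h4 : sliceΓ w = 1 - sliceF w * (w 0 ^ 2 + w 1 ^ 2) := by
    linear_combination (1 - sliceΓ w) * h3 + sliceF w * h1
  exact ⟨h4, by linear_combination -h3 + sliceF w * h4⟩

theorem redHe_eq (P S : ℝ) (w : Red) (hw : w 0 ^ 2 + w 1 ^ 2 ≤ 1) :
    V.redHe P S w = V.redHeFun P S (w 0) (w 1) (w 2) (w 3) (sliceΓ w) (sliceF w) := by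
  obtain ⟨h4, h5⟩ := slice_relations w hw
  have hA : ((relEq P S).A : Matrix (Fin 3) (Fin 3) ℝ) = 1 := rfl
  have hν : momTrans (relEq P S).A (relEq P S).lin = P • e₃ := by
    rw [momTrans, hA, Matrix.one_mulVec]; rfl
  have hθ : momSpin (relEq P S).ang = -S := by simp [momSpin, relEq, e₃]
  have hl : sliceLin (P • e₃) w = ![P * w 0, P * w 1, P * sliceΓ w] := by
    rw [sliceLin, sliceA_eq w hw]
    ext i
    fin_cases i <;> simp [Matrix.mulVec, dotProduct, Fin.sum_univ_three, e₃, mul_comm]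
  set c := sliceΓ w with hc
  set f := sliceF w with hf
  set τ := w 2 * w 0 + w 3 * w 1 with hτ
  have ha : V.sliceAng (P • e₃) (-S) w = ![w 3 + f * w 0 * S - f * w 1 * τ,
      -w 2 + f * w 1 * S + f * w 0 * τ, S] := by
    ext i
    fin_cases i <;> simp [sliceAng, e₃, ← hf, hτ] <;> ring
  have hA22 : sliceA w 2 2 = c := by rw [sliceA_eq w hw]; rfl
  have hen : ∀ (A : Matrix (Fin 3) (Fin 3) ℝ) (a₀ a₁ a₂ l₀ l₁ l₂ : ℝ),
      V.energy A ![a₀, a₁, a₂] ![l₀, l₁, l₂] = 1 / 2 * (V.M₁ / V.Δ * (a₀ ^ 2 + a₁ ^ 2)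
        + 2 * (V.m * V.l / V.Δ) * (a₀ * l₁ - a₁ * l₀) + V.I₁ / V.Δ * (l₀ ^ 2 + l₁ ^ 2)
        + a₂ ^ 2 / V.I₃ + l₂ ^ 2 / V.M₃) - V.m * V.g * V.l * A 2 2 := by
    intro A a₀ a₁ a₂ l₀ l₁ l₂
    simp [energy, angVel, vel, dotProduct, Fin.sum_univ_three, e₃, Matrix.mulVec]
    ring
  rw [redHe, redH, hν, hθ, hl, ha, hen, hA22, redHeFun, ← hτ]
  linear_combination V.M₁ / V.Δ / 2 * (S ^ 2 + τ ^ 2) * h5 - V.m * V.l / V.Δ * P * τ * h4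

theorem hasDerivAt_redHeFun (P S : ℝ) {x₀ x₁ x₂ x₃ c f : ℝ → ℝ}
    {x₀' x₁' x₂' x₃' c' f' t : ℝ} (h₀ : HasDerivAt x₀ x₀' t) (h₁ : HasDerivAt x₁ x₁' t)
    (h₂ : HasDerivAt x₂ x₂' t) (h₃ : HasDerivAt x₃ x₃' t) (hc : HasDerivAt c c' t)
    (hf : HasDerivAt f f' t) :
    HasDerivAt (fun s => V.redHeFun P S (x₀ s) (x₁ s) (x₂ s) (x₃ s) (c s) (f s))
      (V.M₁ / V.Δ * (x₂ t * x₂' + x₃ t * x₃' + S * (f' * (x₃ t * x₀ t - x₂ t * x₁ t)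
          + f t * (x₃' * x₀ t + x₃ t * x₀' - x₂' * x₁ t - x₂ t * x₁')) + S ^ 2 * f'
          - (x₂ t * x₀ t + x₃ t * x₁ t) * (x₂' * x₀ t + x₂ t * x₀' + x₃' * x₁ t + x₃ t * x₁'))
        + V.m * V.l / V.Δ * P * ((x₂' * x₀ t + x₂ t * x₀' + x₃' * x₁ t + x₃ t * x₁') * c t
          + (x₂ t * x₀ t + x₃ t * x₁ t) * c')
        + V.I₁ / V.Δ * P ^ 2 * (x₀ t * x₀' + x₁ t * x₁') + P ^ 2 / V.M₃ * (c t * c')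
        - V.m * V.g * V.l * c') t := by
  have hτ := (h₂.mul h₀).add (h₃.mul h₁)
  have hk := ((((h₂.pow 2).add (h₃.pow 2)).add
    ((hf.mul ((h₃.mul h₀).sub (h₂.mul h₁))).const_mul (2 * S))).add
    (((hf.const_mul 2).sub_const 1).const_mul (S ^ 2))).sub (hτ.pow 2)
  have h := ((((((hk.const_mul (V.M₁ / V.Δ)).add
    ((hτ.mul hc).const_mul (2 * (V.m * V.l / V.Δ * P)))).add
    (((h₀.pow 2).add (h₁.pow 2)).const_mul (V.I₁ / V.Δ * P ^ 2))).add_const (S ^ 2 / V.I₃)).add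
    ((hc.pow 2).const_mul (P ^ 2 / V.M₃))).const_mul (1 / 2)).sub
    (hc.const_mul (V.m * V.g * V.l))
  refine (h.congr_of_eventuallyEq (.of_forall fun s => ?_)).congr_deriv ?_
  · simp [redHeFun]
  · simp; ring

/-- The symmetric matrix `M(w)` for which the gradient of the reduced Hamiltonian is `M(w) w`. -/
def gradMatrix (P S : ℝ) (w : Red) : Matrix (Fin 4) (Fin 4) ℝ :=
  let c := sliceΓ w
  let f := sliceF w
  let τ := w 2 * w 0 + w 3 * w 1
  let a := V.M₁ / V.Δ
  let N := a * (f ^ 2 / c) * (S * (w 3 * w 0 - w 2 * w 1) + S ^ 2) - V.m * V.l / V.Δ * P * τ / c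
    + V.I₁ / V.Δ * P ^ 2 - P ^ 2 / V.M₃ + V.m * V.g * V.l / c
  let n := V.m * V.l / V.Δ * P * c - a * τ
  !![N, 0, n, a * f * S;
    0, N, -(a * f * S), n;
    n, -(a * f * S), a, 0;
    a * f * S, n, 0, a]

theorem fderiv_redHe (P S : ℝ) (w : Red) (hw : w 0 ^ 2 + w 1 ^ 2 < 1) (k : Fin 4) :
    fderiv ℝ (V.redHe P S) w (Pi.single k 1) = (V.gradMatrix P S w *ᵥ w) k := by
  have hpos : 0 < sliceΓ w := Real.sqrt_pos.2 (by linarith)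
  have hdiff : DifferentiableAt ℝ (V.redHe P S) w :=
    (V.contDiffAt_redH _ _ w hw).differentiableAt (by simp)
  have heq : V.redHe P S =ᶠ[𝓝 w] fun u =>
      V.redHeFun P S (u 0) (u 1) (u 2) (u 3) (sliceΓ u) (sliceF u) := by
    have hc : Continuous fun u : Red => u 0 ^ 2 + u 1 ^ 2 := by fun_prop
    filter_upwards [hc.continuousAt.eventually_lt_const hw] with u hu
    exact V.redHe_eq P S u hu.le
  have hx : ∀ i : Fin 4, HasDerivAt (fun s => Function.update w k s i)
      ((Pi.single k 1 : Red) i) (w k) := fun i =>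
    hasDerivAt_pi.1 (hasDerivAt_update (𝕜 := ℝ) w k (w k)) i
  have main : ∀ c', HasDerivAt (fun s => sliceΓ (Function.update w k s)) c' (w k) → _ :=
    fun c' hc => fderiv_single_of_hasDerivAt_update (heq.differentiableAt_iff.1 hdiff)
      (V.hasDerivAt_redHeFun P S (hx 0) (hx 1) (hx 2) (hx 3) hc (hasDerivAt_sliceF w k c' hc))
  have hconst : ∀ j : Fin 4, j ≠ 0 → j ≠ 1 →
      HasDerivAt (fun s => sliceΓ (Function.update w j s)) 0 (w j) := by
    intro j h0 h1
    simp only [sliceΓ, Function.update_of_ne h0.symm, Function.update_of_ne h1.symm]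
    exact hasDerivAt_const _ _
  have hF : sliceF w = 1 / (1 + sliceΓ w) := rfl
  rw [heq.fderiv_eq]
  fin_cases k
  · refine (main _ (hasDerivAt_sliceΓ w hw).1).trans ?_
    simp [gradMatrix, Matrix.mulVec, dotProduct, Fin.sum_univ_four, hF]
    field_simp
    ring
  · refine (main _ (hasDerivAt_sliceΓ w hw).2).trans ?_
    simp [gradMatrix, Matrix.mulVec, dotProduct, Fin.sum_univ_four, hF]
    field_simp
    ring
  · refine (main _ (hconst 2 (by decide) (by decide))).trans ?_
    simp [gradMatrix, Matrix.mulVec, dotProduct, Fin.sum_univ_four]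
    ring
  · refine (main _ (hconst 3 (by decide) (by decide))).trans ?_
    simp [gradMatrix, Matrix.mulVec, dotProduct, Fin.sum_univ_four]
    ring

/-- The common form of the Hessians of the reduced Hamiltonian at the relative equilibria, in the
order `(q₁, q₂, p₁, p₂)` of the coordinates; `σ` is the gyroscopic term due to the spin. -/
def hessianForm (a N β σ : ℝ) : Matrix (Fin 4) (Fin 4) ℝ :=
  !![N, 0, β, σ;
    0, N, -σ, β;
    β, -σ, a, 0;
    σ, β, 0, a]

theorem redHe_critical_hessian (P S : ℝ) :
    fderiv ℝ (V.redHe P S) 0 = 0 ∧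
      hessian (V.redHe P S) = hessianForm (V.M₁ / V.Δ)
        (V.M₁ / V.Δ * S ^ 2 / 4 + V.I₁ / V.Δ * P ^ 2 - P ^ 2 / V.M₃ + V.m * V.g * V.l)
        (V.m * V.l / V.Δ * P) (V.M₁ / V.Δ * S / 2) := by
  have hΓ0 : sliceΓ 0 = 1 := by simp [sliceΓ]
  have hF0 : sliceF 0 = 1 / 2 := by rw [sliceF, hΓ0]; norm_num
  have hcΓ : ContinuousAt sliceΓ 0 := by unfold sliceΓ; fun_prop
  have hcF : ContinuousAt sliceF 0 := by
    unfold sliceF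
    exact continuousAt_const.div (continuousAt_const.add hcΓ) (by rw [hΓ0]; norm_num)
  have hM : ∀ i j, ContinuousAt (fun w => V.gradMatrix P S w i j) 0 := by
    have hne : sliceΓ 0 ≠ 0 := by rw [hΓ0]; exact one_ne_zero
    intro i j
    fin_cases i <;> fin_cases j <;> simp [gradMatrix] <;> fun_prop (disch := exact hne)
  have hg : ∀ᶠ w in 𝓝 (0 : Red), ∀ k,
      fderiv ℝ (V.redHe P S) w (Pi.single k 1) = (V.gradMatrix P S w *ᵥ w) k := by
    have hc : Continuous fun u : Red => u 0 ^ 2 + u 1 ^ 2 := by fun_prop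
    filter_upwards [hc.continuousAt.eventually_lt_const
      (by simp : (0 : Red) 0 ^ 2 + (0 : Red) 1 ^ 2 < 1)] with w hw k
    exact V.fderiv_redHe P S w hw k
  obtain ⟨h1, h2⟩ := hessian_of_gradient hM hg
  refine ⟨h1, h2.trans ?_⟩
  ext i j
  fin_cases i <;> fin_cases j <;> simp [gradMatrix, hessianForm, hΓ0, hF0] <;> ring

/-! ### Definiteness and the spectrum -/

/-- `a` times the quadratic form is
`(a p₁ + β q₁ - σ q₂)² + (a p₂ + β q₂ + σ q₁)² + (a N - β² - σ²) (q₁² + q₂²)`. -/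
theorem hessianForm_posDef {a N β σ : ℝ} (ha : 0 < a) (hD : 0 < a * N - β ^ 2 - σ ^ 2) :
    (hessianForm a N β σ).PosDef := by
  refine Matrix.PosDef.of_dotProduct_mulVec_pos ?_ fun x hx => ?_
  · ext i j
    fin_cases i <;> fin_cases j <;> simp [hessianForm]
  · have hsq : a * (star x ⬝ᵥ (hessianForm a N β σ *ᵥ x)) =
        (a * x 2 + β * x 0 - σ * x 1) ^ 2 + (a * x 3 + β * x 1 + σ * x 0) ^ 2
          + (a * N - β ^ 2 - σ ^ 2) * (x 0 ^ 2 + x 1 ^ 2) := by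
      simp [hessianForm, Matrix.mulVec, dotProduct, Fin.sum_univ_four]
      ring
    refine pos_of_mul_pos_right (a := a) ?_ ha.le
    rw [hsq]
    by_cases h : x 0 ^ 2 + x 1 ^ 2 = 0
    · obtain ⟨h0, h1, -⟩ := sq_add_sq_add_sq_eq_zero (c := 0)
        (by linarith : x 0 ^ 2 + x 1 ^ 2 + 0 ^ 2 = 0)
      have hne : x 2 ≠ 0 ∨ x 3 ≠ 0 := by
        by_contra! hcon
        exact hx (by ext i; fin_cases i <;> simp [h0, h1, hcon])
      simp only [h0, h1, mul_zero, add_zero, sub_zero]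
      rcases hne with h2 | h3 <;> positivity
    · have : 0 < x 0 ^ 2 + x 1 ^ 2 := lt_of_le_of_ne (by positivity) (Ne.symm h)
      positivity

/-- The characteristic equation is `(z² + D)² + 4 σ² z² = 0` with `D = a N - β² - σ²`, that is
`(z ∓ iσ)² = -(a N - β²)`. -/
theorem re_eq_zero_of_mem_spectrum {a N β σ : ℝ} (hA : 0 < a * N - β ^ 2) {z : ℂ}
    (hz : z ∈ spectrum ℂ ((sympJ * hessianForm a N β σ).map (algebraMap ℝ ℂ))) : z.re = 0 := by
  have key : ∀ s : ℝ, (z - Complex.I * s) ^ 2 = -((a * N - β ^ 2 : ℝ) : ℂ) → z.re = 0 := by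
    intro s h
    have h1 := congrArg Complex.re h
    have h2 := congrArg Complex.im h
    simp only [sq, Complex.mul_re, Complex.mul_im, Complex.sub_re, Complex.sub_im, Complex.I_re,
      Complex.I_im, Complex.ofReal_re, Complex.ofReal_im, Complex.neg_re, Complex.neg_im] at h1 h2
    simp at h1 h2
    rcases (by linarith : z.re * (z.im - s) = 0) |> mul_eq_zero.1 with h3 | h3
    · exact h3
    · rw [h3] at h1
      nlinarith [mul_self_nonneg z.re]
  rw [spectrum.mem_iff, Matrix.isUnit_iff_isUnit_det, isUnit_iff_ne_zero, not_not] at hz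
  have hmat : (algebraMap ℂ (Matrix (Fin 4) (Fin 4) ℂ) z
      - (sympJ * hessianForm a N β σ).map (algebraMap ℝ ℂ)) =
      !![z - β, σ, -a, 0; -σ, z - β, 0, -a; N, 0, z + β, σ; 0, N, -σ, z + β] := by
    ext i j
    fin_cases i <;> fin_cases j <;>
      simp [sympJ, hessianForm, Matrix.algebraMap_matrix_apply]
  rw [hmat] at hz
  have hdet : ((z - Complex.I * σ) ^ 2 + ((a * N - β ^ 2 : ℝ) : ℂ))
      * ((z + Complex.I * σ) ^ 2 + ((a * N - β ^ 2 : ℝ) : ℂ)) = 0 := by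
    rw [← hz]
    simp [Matrix.det_succ_row_zero, Fin.sum_univ_succ, Fin.succAbove]
    ring_nf
    simp only [Complex.I_sq, show Complex.I ^ 4 = 1 from Complex.I_pow_four]
    ring
  rcases mul_eq_zero.1 hdet with h | h
  · exact key σ (by linear_combination h)
  · exact key (-σ) (by push_cast at h ⊢; linear_combination h)

end Vehicle

end Kirchhoff

end

theorem mainTheorem2 (V : Kirchhoff.Vehicle)
    (hI₁ : 0 < V.I₁) (hI₃ : 0 < V.I₃) (hM₁ : 0 < V.M₁) (hM₃ : 0 < V.M₃)
    (hΔ : 0 < V.I₁ * V.M₁ - V.m ^ 2 * V.l ^ 2) (P S : ℝ) :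
    (V.m * V.g * V.l > (1 / V.M₃ - 1 / V.M₁) * P ^ 2 →
      V.IsEMConfined P S ∧ V.IsSymStable (Kirchhoff.relEq P S)) ∧
    (V.m * V.g * V.l > (1 / V.M₃ - 1 / V.M₁) * P ^ 2
        - V.M₁ / (4 * (V.I₁ * V.M₁ - V.m ^ 2 * V.l ^ 2)) * S ^ 2 →
      V.IsSpectrallyStable P S) := by
  have hd : V.I₁ * V.M₁ - V.m ^ 2 * V.l ^ 2 = V.Δ := rfl
  rw [hd] at hΔ ⊢
  have ha : 0 < V.M₁ / V.Δ := by positivity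
  obtain ⟨hcrit, hhess⟩ := V.redHe_critical_hessian P S
  have hA : V.M₁ / V.Δ * (V.M₁ / V.Δ * S ^ 2 / 4 + V.I₁ / V.Δ * P ^ 2 - P ^ 2 / V.M₃
        + V.m * V.g * V.l) - (V.m * V.l / V.Δ * P) ^ 2
      = V.M₁ / V.Δ * (V.m * V.g * V.l - ((1 / V.M₃ - 1 / V.M₁) * P ^ 2
        - V.M₁ / (4 * V.Δ) * S ^ 2)) := by
    have hI : V.I₁ = (V.Δ + V.m ^ 2 * V.l ^ 2) / V.M₁ := by
      rw [eq_div_iff hM₁.ne', ← hd]; ring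
    rw [hI]
    field_simp
    ring
  refine ⟨fun hK => ⟨⟨hcrit, Or.inl ?_⟩, Kirchhoff.Vehicle.isSymStable_relEq hI₃ hM₁ hM₃ hΔ hK⟩,
    fun hK => ⟨hcrit, fun z hz => ?_⟩⟩
  · rw [hhess]
    refine Kirchhoff.Vehicle.hessianForm_posDef ha ?_
    have h := mul_pos ha (sub_pos.2 hK)
    have e : V.M₁ / V.Δ * (V.M₁ / (4 * V.Δ) * S ^ 2) = (V.M₁ / V.Δ * S / 2) ^ 2 := by
      field_simp
      ring
    rw [hA, mul_sub, mul_sub, e]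
    rw [mul_sub] at h
    linarith
  · rw [hhess] at hz
    refine Kirchhoff.Vehicle.re_eq_zero_of_mem_spectrum ?_ hz
    rw [hA]
    exact mul_pos ha (sub_pos.2 hK)
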